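/- \textbf{Setting.} Fix a countably infinite set $\mathrm{Var}$ of variables and a countable set of predicate symbols with arities. Formulas of $\mathrm{MILL}1$ (first-order multiplicative intuitionistic linear logic), taken up to renaming of bound variables, are built from atoms $p(x_1,\dots,x_n)$ with $\otimes,\multimap,\exists,\forall$. Sequents are $\Gamma\vdash B$ with $\Gamma$ a finite multiset of formulas. The axioms are $A\vdash A$, and the rules are $$\frac{\Gamma,A,B\vdash C}{\Gamma,A\otimes B\vdash C}\qquad \frac{\Gamma\vdash A\quad\Delta\vdash B}{\Gamma,\Delta\vdash A\otimes B}\qquad \frac{\Pi\vdash B\quad\Gamma,A\vdash C}{\Gamma,\Pi,B\multimap A\vdash C}\qquad \frac{\Gamma,B\vdash A}{\Gamma\vdash B\multimap A}$$ $$\frac{\Gamma,A[z/x]\vdash B}{\Gamma,\exists xA\vdash B}\qquad \frac{\Gamma\vdash A[y/x]}{\Gamma\vdash\exists xA}\qquad \frac{\Gamma,A[y/x]\vdash B}{\Gamma,\forall xA\vdash B}\qquad \frac{\Gamma\vdash A[z/x]}{\Gamma\vdash\forall xA}$$ where $y$ is any variable and $z$ is not free in the conclusion. $\mathrm{MILL}1(\multimap,\forall)$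 is the calculus on formulas built with $\multimap,\forall$ only, with the axioms $A\vdash A$ and the rules for $\multimap$ and $\forall$. Let $T$ be a set of labels, each $c\in T$ having a finite set $\mathrm{type}(c)\subseteq\mathrm{Var}$. A hypergraph $H$ over $T$ consists of a finite set $V$ of nodes, a finite set $E$ of hyperedges, labels $\mathrm{lab}(e)\in T$, attachments $\mathrm{att}(e):\mathrm{type}(\mathrm{lab}(e))\to V$ and a partial function $\mathrm{ext}_H$ from $\mathrm{Var}$ to $V$, whose domain is $\mathrm{type}(H)$. Hypergraphs are considered up to isomorphism. $K_0$ is the empty hypergraph. The parallel composition $H_1/\!/H_2$ is obtained from the disjoint union of $H_1$ and $H_2$ by fusing $\mathrm{ext}_{H_1}(\sigma)$ with $\mathrm{ext}_{H_2}(\sigma)$ for all $\sigma\in\mathrm{type}(H_1)\cap\mathrm{type}(H_2)$; its external function is the union of the two. For $h:\mathrm{Var}\to\mathrm{Var}$, $\mathrm{sub}_h(H)$ is obtained from $H$ by fusing $\mathrm{ext}_H(\sigma)$ and $\mathrm{ext}_H(\tau)$ whenever $\sigma,\tau\in\mathrm{type}(H)$ and $h(\sigma)=h(\tau)$, with new type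 $h(\mathrm{type}(H))$ and $\mathrm{ext}(h(\sigma))=[\mathrm{ext}_H(\sigma)]$. On sets of hypergraphs, $/\!/$ and $\mathrm{sub}_h$ are taken elementwise. A \emph{hypergraph language model} is a pair $\langle T,u\rangle$ where $u$ maps each formula of $\mathrm{MILL}1$ to a set of hypergraphs over $T$ (closed under isomorphism) such that \begin{enumerate} \item $\mathrm{sub}_h(u(A))\subseteq u(A[h])$ for every $h:\mathrm{Var}\to\mathrm{Var}$, where $A[h]$ is the capture-avoiding replacement of each free variable $x$ of $A$ by $h(x)$; \item $u(A\otimes B)=u(A)/\!/u(B)$; \item $u(A\multimap B)=\{H\mid \forall H'\in u(A)\;\; H/\!/H'\in u(B)\}$; \item $u(\exists xA)=\bigcup_{y\in\mathrm{Var}}u(A[y/x])$; \item $u(\forall xA)=\bigcap_{y\in\mathrm{Var}}u(A[y/x])$. \end{enumerate} A sequent $A_1,\dots,A_n\vdash B$ is \emph{true} in the model if $u(A_1)/\!/\cdots/\!/u(A_n)\subseteq u(B)$ (for $n=0$: if $K_0\in u(B)$). \textbf{Theorem.} \begin{enumerate} \item (Soundness.) Every sequent derivable in $\mathrm{MILL}1$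 is true in every hypergraph language model. \item (Completeness of the $\{\multimap,\forall\}$-fragment.) If all formulas of a sequent are built with $\multimap$ and $\forall$ only and the sequent is true in every hypergraph language model, then it is derivable in $\mathrm{MILL}1(\multimap,\forall)$. \end{enumerate} -/

import Mathlib

namespace MILL

/-! Formulas of first-order multiplicative intuitionistic linear logic.

Formulas are taken up to renaming of bound variables: `PreFormula Var arity n` consists of the
formulas whose free variables are named by elements of `Var` and which may moreover contain `n`
dangling (de Bruijn) indices.  A formula is a preformula without dangling indices. -/

inductive PreFormula (Var : Type) {Pred : Type} (arity : Pred → ℕ) : ℕ → Type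
  | atom {n : ℕ} (p : Pred) (t : Fin (arity p) → Var ⊕ Fin n) : PreFormula Var arity n
  | tensor {n : ℕ} (A B : PreFormula Var arity n) : PreFormula Var arity n
  | limp {n : ℕ} (A B : PreFormula Var arity n) : PreFormula Var arity n
  | ex {n : ℕ} (A : PreFormula Var arity (n + 1)) : PreFormula Var arity n
  | all {n : ℕ} (A : PreFormula Var arity (n + 1)) : PreFormula Var arity n

abbrev Formula (Var : Type) {Pred : Type} (arity : Pred → ℕ) : Type := PreFormula Var arity 0

namespace PreFormula

variable {Var Pred : Type} {arity : Pred → ℕ}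

/-- The set of (named) free variables. -/
def FVar : {n : ℕ} → PreFormula Var arity n → Set Var
  | _, atom _ t => {x | ∃ i, t i = Sum.inl x}
  | _, tensor A B => A.FVar ∪ B.FVar
  | _, limp A B => A.FVar ∪ B.FVar
  | _, ex A => A.FVar
  | _, all A => A.FVar

/-- `A.subst h` is `A[h]`: every free variable `x` is replaced by `h x`. No capture can occur. -/
def subst (h : Var → Var) : {n : ℕ} → PreFormula Var arity n → PreFormula Var arity n
  | _, atom p t => atom p (fun i => Sum.map h id (t i))
  | _, tensor A B => tensor (A.subst h) (B.subst h)
  | _, limp A B => limp (A.subst h) (B.subst h)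
  | _, ex A => ex (A.subst h)
  | _, all A => all (A.subst h)

/-- Extend a replacement of the dangling indices under one more binder, whose own index `0` stays
in place. -/
def liftIdx {m k : ℕ} (f : Fin m → Var ⊕ Fin k) : Fin (m + 1) → Var ⊕ Fin (k + 1) :=
  Fin.cases (Sum.inr 0) (fun i => Sum.map id Fin.succ (f i))

/-- Replace the dangling indices according to `f`. -/
def bindIdx : {m k : ℕ} → (Fin m → Var ⊕ Fin k) → PreFormula Var arity m → PreFormula Var arity k
  | _, _, f, atom p t => atom p (fun i => Sum.elim Sum.inl f (t i))
  | _, _, f, tensor A B => tensor (A.bindIdx f) (B.bindIdx f)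
  | _, _, f, limp A B => limp (A.bindIdx f) (B.bindIdx f)
  | _, _, f, ex A => ex (A.bindIdx (liftIdx f))
  | _, _, f, all A => all (A.bindIdx (liftIdx f))

/-- If `A` is the body of a quantified formula `∀ x A` or `∃ x A`, then `A.inst y` is `A[y/x]`. -/
def inst (A : PreFormula Var arity 1) (y : Var) : Formula Var arity :=
  A.bindIdx (fun _ => Sum.inl y)

/-- The formula is built from atomic formulas with `⊸` and `∀` only. -/
def IsImpAll : {n : ℕ} → PreFormula Var arity n → Prop
  | _, atom _ _ => True
  | _, tensor _ _ => False
  | _, limp A B => A.IsImpAll ∧ B.IsImpAll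
  | _, ex _ => False
  | _, all A => A.IsImpAll

end PreFormula

open PreFormula

/-- Derivability of the sequent `Γ ⊢ C` in MILL1 (without the cut rule). -/
inductive Derivable {Var Pred : Type} {arity : Pred → ℕ} :
    Multiset (Formula Var arity) → Formula Var arity → Prop
  | ax (A : Formula Var arity) : Derivable {A} A
  | tensorL {Γ : Multiset (Formula Var arity)} {A B C : Formula Var arity} :
      Derivable (A ::ₘ B ::ₘ Γ) C → Derivable (tensor A B ::ₘ Γ) C
  | tensorR {Γ Δ : Multiset (Formula Var arity)} {A B : Formula Var arity} :
      Derivable Γ A → Derivable Δ B → Derivable (Γ + Δ) (tensor A B)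
  | limpL {Γ Δ : Multiset (Formula Var arity)} {A B C : Formula Var arity} :
      Derivable Δ B → Derivable (A ::ₘ Γ) C → Derivable (limp B A ::ₘ (Γ + Δ)) C
  | limpR {Γ : Multiset (Formula Var arity)} {A B : Formula Var arity} :
      Derivable (B ::ₘ Γ) A → Derivable Γ (limp B A)
  | exL {Γ : Multiset (Formula Var arity)} {A : PreFormula Var arity 1} {B : Formula Var arity}
      {z : Var} : (∀ C ∈ Γ, z ∉ C.FVar) → z ∉ A.FVar → z ∉ B.FVar →
      Derivable (A.inst z ::ₘ Γ) B → Derivable (ex A ::ₘ Γ) B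
  | exR {Γ : Multiset (Formula Var arity)} {A : PreFormula Var arity 1} {y : Var} :
      Derivable Γ (A.inst y) → Derivable Γ (ex A)
  | allL {Γ : Multiset (Formula Var arity)} {A : PreFormula Var arity 1} {B : Formula Var arity}
      {y : Var} : Derivable (A.inst y ::ₘ Γ) B → Derivable (all A ::ₘ Γ) B
  | allR {Γ : Multiset (Formula Var arity)} {A : PreFormula Var arity 1} {z : Var} :
      (∀ C ∈ Γ, z ∉ C.FVar) → z ∉ A.FVar →
      Derivable Γ (A.inst z) → Derivable Γ (all A)

/-- Derivability in the fragment of MILL1 with the connectives `⊸` and `∀` only: the axioms are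
restricted to formulas of the fragment, and only the rules for `⊸` and `∀` are available. -/
inductive DerivableImpAll {Var Pred : Type} {arity : Pred → ℕ} :
    Multiset (Formula Var arity) → Formula Var arity → Prop
  | ax (A : Formula Var arity) : A.IsImpAll → DerivableImpAll {A} A
  | limpL {Γ Δ : Multiset (Formula Var arity)} {A B C : Formula Var arity} :
      DerivableImpAll Δ B → DerivableImpAll (A ::ₘ Γ) C →
      DerivableImpAll (limp B A ::ₘ (Γ + Δ)) C
  | limpR {Γ : Multiset (Formula Var arity)} {A B : Formula Var arity} :
      DerivableImpAll (B ::ₘ Γ) A → DerivableImpAll Γ (limp B A)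
  | allL {Γ : Multiset (Formula Var arity)} {A : PreFormula Var arity 1} {B : Formula Var arity}
      {y : Var} : DerivableImpAll (A.inst y ::ₘ Γ) B → DerivableImpAll (all A ::ₘ Γ) B
  | allR {Γ : Multiset (Formula Var arity)} {A : PreFormula Var arity 1} {z : Var} :
      (∀ C ∈ Γ, z ∉ C.FVar) → z ∉ A.FVar →
      DerivableImpAll Γ (A.inst z) → DerivableImpAll Γ (all A)

/-- A (concrete) hypergraph over the typed alphabet `T`, where `type c` is the finite set of
selectors of the label `c`. The function `ext` is partial: its domain is the type of the
hypergraph, and `ext σ = none` means that `σ` is not in this domain. -/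
structure LabHypergraph {Var : Type} {T : Type*} (type : T → Finset Var) where
  V : Type
  E : Type
  finV : Finite V
  finE : Finite E
  lab : E → T
  att : (e : E) → {σ : Var // σ ∈ type (lab e)} → V
  ext : Var → Option V

namespace LabHypergraph

variable {Var : Type} {T : Type*} {type : T → Finset Var}

/-- Two hypergraphs are isomorphic, i.e. they represent the same abstract hypergraph. -/
def Iso (H K : LabHypergraph type) : Prop :=
  ∃ (f : H.V ≃ K.V) (g : H.E ≃ K.E),
    (∀ e, K.lab (g e) = H.lab e) ∧
    (∀ e σ (h₁ : σ ∈ type (H.lab e)) (h₂ : σ ∈ type (K.lab (g e))),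
      K.att (g e) ⟨σ, h₂⟩ = f (H.att e ⟨σ, h₁⟩)) ∧
    (∀ σ, K.ext σ = (H.ext σ).map f)

/-- The empty hypergraph. -/
def empty (type : T → Finset Var) : LabHypergraph type where
  V := Empty
  E := Empty
  finV := inferInstance
  finE := inferInstance
  lab := Empty.elim
  att := fun e => e.elim
  ext := fun _ => none

/-- The relation on nodes that parallel composition glues along. -/
def ParRel (H K : LabHypergraph type) (v w : H.V ⊕ K.V) : Prop :=
  ∃ (σ : Var) (a : H.V) (b : K.V),
    H.ext σ = some a ∧ K.ext σ = some b ∧ v = Sum.inl a ∧ w = Sum.inr b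

/-- Parallel composition. (`Quot r` is the quotient by the least equivalence relation
containing `r`.) -/
def par (H K : LabHypergraph type) : LabHypergraph type where
  V := Quot (ParRel H K)
  E := H.E ⊕ K.E
  finV := by
    have := H.finV
    have := K.finV
    infer_instance
  finE := by
    have := H.finE
    have := K.finE
    infer_instance
  lab := Sum.elim H.lab K.lab
  att := fun e => match e with
    | Sum.inl e => fun σ => Quot.mk _ (Sum.inl (H.att e σ))
    | Sum.inr e => fun σ => Quot.mk _ (Sum.inr (K.att e σ))
  ext := fun σ =>
    ((H.ext σ).map fun v => Quot.mk _ (Sum.inl v)).or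
      ((K.ext σ).map fun v => Quot.mk _ (Sum.inr v))

theorem par_ext_left (H K : LabHypergraph type) {σ : Var} {v : H.V} (hv : H.ext σ = some v) :
    (H.par K).ext σ = some (Quot.mk _ (Sum.inl v)) := by
  simp [par, hv]

theorem par_ext_right (H K : LabHypergraph type) {σ : Var} {v : K.V} (hv : K.ext σ = some v) :
    (H.par K).ext σ = some (Quot.mk _ (Sum.inr v)) := by
  cases hH : H.ext σ with
  | none => simp [par, hv, hH]
  | some a =>
    simp only [par, hH, hv, Option.map_some, Option.some_or, Option.some.injEq]
    exact Quot.sound ⟨σ, a, v, hH, hv, rfl, rfl⟩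

/-- The relation on nodes that the substitution along `h` glues along. -/
def SubRel (h : Var → Var) (H : LabHypergraph type) (v w : H.V) : Prop :=
  ∃ σ τ : Var, h σ = h τ ∧ H.ext σ = some v ∧ H.ext τ = some w

open Classical in
/-- The substitution `sub_h(H)` for a total function `h` on selectors: external nodes whose
selectors have the same image under `h` are fused, and the node with selector `σ` receives the
selector `h σ`. -/
noncomputable def sub (h : Var → Var) (H : LabHypergraph type) : LabHypergraph type where
  V := Quot (SubRel h H)
  E := H.E
  finV := by
    have := H.finV
    infer_instance
  finE := H.finE
  lab := H.lab
  att := fun e σ => Quot.mk _ (H.att e σ)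
  ext := fun τ =>
    if hτ : ∃ (v : H.V) (σ : Var), h σ = τ ∧ H.ext σ = some v
    then some (Quot.mk _ hτ.choose) else none

theorem sub_ext (h : Var → Var) (H : LabHypergraph type) {σ : Var} {v : H.V}
    (hv : H.ext σ = some v) : (H.sub h).ext (h σ) = some (Quot.mk _ v) := by
  have hτ : ∃ (w : H.V) (ρ : Var), h ρ = h σ ∧ H.ext ρ = some w := ⟨v, σ, rfl, hv⟩
  obtain ⟨ρ, h₁, h₂⟩ := hτ.choose_spec
  simp only [sub, dif_pos hτ, Option.some.injEq]
  exact Quot.sound ⟨ρ, σ, h₁, h₂, hv⟩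

/-- Elementwise parallel composition of two languages (up to isomorphism). -/
def langPar (L M : Set (LabHypergraph type)) : Set (LabHypergraph type) :=
  {K | ∃ H₁ ∈ L, ∃ H₂ ∈ M, Iso (H₁.par H₂) K}

end LabHypergraph

open LabHypergraph

/-- A hypergraph language model of MILL1 over the typed alphabet `T`. Selectors and variables are
the same objects; sets of abstract hypergraphs are sets of hypergraphs closed under isomorphism. -/
structure HypergraphLanguageModel {Var Pred : Type} (arity : Pred → ℕ) {T : Type*}
    (type : T → Finset Var) where
  u : Formula Var arity → Set (LabHypergraph type)
  iso_closed : ∀ (A : Formula Var arity) (H K : LabHypergraph type), Iso H K → H ∈ u A → K ∈ u A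
  sub_mem : ∀ (h : Var → Var) (A : Formula Var arity), ∀ H ∈ u A, H.sub h ∈ u (A.subst h)
  tensor_eq : ∀ A B : Formula Var arity, u (tensor A B) = langPar (u A) (u B)
  limp_eq : ∀ A B : Formula Var arity, u (limp A B) = {H | ∀ H' ∈ u A, H.par H' ∈ u B}
  ex_eq : ∀ A : PreFormula Var arity 1, u (ex A) = ⋃ y : Var, u (A.inst y)
  all_eq : ∀ A : PreFormula Var arity 1, u (all A) = ⋂ y : Var, u (A.inst y)

namespace HypergraphLanguageModel

variable {Var Pred : Type} {arity : Pred → ℕ} {T : Type*} {type : T → Finset Var}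

/-- The parallel composition of the languages of the formulas in a list; for the empty list this
is the language of the empty hypergraph. -/
def antecedent (M : HypergraphLanguageModel arity type) :
    List (Formula Var arity) → Set (LabHypergraph type)
  | [] => {K | Iso (LabHypergraph.empty type) K}
  | A :: Γ => langPar (M.u A) (M.antecedent Γ)

/-- The sequent `A₁, …, Aₙ ⊢ B` is true in the model. -/
def Holds (M : HypergraphLanguageModel arity type) (Γ : List (Formula Var arity))
    (B : Formula Var arity) : Prop :=
  M.antecedent Γ ⊆ M.u B

end HypergraphLanguageModel

end MILL

/-!
Soundness is an induction on derivations. Up to isomorphism, parallel composition is commutative and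
associative with unit `K₀`, so an antecedent has an interpretation as a multiset. For the rules with
an eigenvariable, the induction is over all substitution instances of the sequent at once
(`HypergraphLanguageModel.interp_subset_of_derivable`).

Completeness uses a canonical model. Its labels are the formulas; a hyperedge labelled by `A` has
the free variables of `A` as selectors. Once the nodes of a hypergraph `H` are given names `g`, its
hyperedges become a multiset of formulas `H.edgeForms g`. The language of an atom `p` consists of
the hypergraphs with finitely many selectors such that, for all names `g` of the nodes and all
renamings `k` of variables that agree on external nodes, `H.edgeForms g ⊢ p[k]` is derivable
(`Proves`, up to one additional label explained below). The languages of the other formulas are then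
forced (`lang`).

The main difficulty is that this is a model, that is, that `sub h` maps the language of `A` into
that of `A[h]`, for all formulas of MILL1. For an implication `A ⊸ B` this requires information on
the language of `A[h]` in terms of that of `A`, opposite to the claim. So two closure properties are
proved together (`lang_fuses_and_pull`). One, more flexible than closure under `sub h`, is closure
under fusions (`Fuses`): nodes may be identified if they become external, and isolated external
nodes may appear or disappear. This is inherited by parallel compositions since every fusion of one
is a parallel composition of fusions (`Fuses.exists_par`). The other is closure under pulling
selectors back along `h`, which holds when `h` is onto and fails to be injective only at selectors
in use. Since only finitely many selectors and variables matter, any `h` may be replaced by such a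
renaming (`exists_almostBij`).

That only finitely many selectors matter is where finiteness of types enters. The condition passes
from `A` and `B` to `A ⊸ B` if the language of `A` is nonempty. The labels therefore include an
additional one, for hyperedges that make everything derivable
(`finiteType_and_exists_absorbing`).

Finally, for formulas of the fragment, the hypergraph with a single hyperedge `A` belongs to the
language of `A`, and every member of this language without the additional label proves `A`
(`mem_lang_of_refines_and_proves_of_mem_lang`). If `A₁, …, Aₙ ⊢ B` is true in the canonical model,
the parallel composition of the single hyperedges for `A₁, …, Aₙ` is in the language of `B`, so
that the sequent is derivable.
-/

/-! ### Simultaneous substitution -/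

namespace MILL

namespace PreFormula

variable {Var Pred : Type} {arity : Pred → ℕ}

/-- Extend a substitution for variables and dangling indices under one more binder. -/
def liftSubst {m k : ℕ} (s : Var ⊕ Fin m → Var ⊕ Fin k) : Var ⊕ Fin (m + 1) → Var ⊕ Fin (k + 1) :=
  Sum.elim (fun x => Sum.map id Fin.succ (s (Sum.inl x)))
    (Fin.cases (Sum.inr 0) fun i => Sum.map id Fin.succ (s (Sum.inr i)))

/-- Simultaneous substitution for the free variables and the dangling indices. Both `subst` and
`bindIdx` are special cases, and substitutions compose as functions. -/
def msubst : {m k : ℕ} → (Var ⊕ Fin m → Var ⊕ Fin k) → PreFormula Var arity m →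
    PreFormula Var arity k
  | _, _, s, atom p t => atom p (fun i => s (t i))
  | _, _, s, tensor A B => tensor (A.msubst s) (B.msubst s)
  | _, _, s, limp A B => limp (A.msubst s) (B.msubst s)
  | _, _, s, ex A => ex (A.msubst (liftSubst s))
  | _, _, s, all A => all (A.msubst (liftSubst s))

theorem liftSubst_comp {l m k : ℕ} (s : Var ⊕ Fin m → Var ⊕ Fin k)
    (r : Var ⊕ Fin l → Var ⊕ Fin m) :
    liftSubst s ∘ liftSubst r = liftSubst (s ∘ r) := by
  funext x
  rcases x with x | i
  · simp only [liftSubst, Function.comp, Sum.elim_inl]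
    cases r (Sum.inl x) <;> simp
  · refine Fin.cases ?_ (fun i => ?_) i
    · simp [liftSubst]
    · simp only [liftSubst, Function.comp, Sum.elim_inr, Fin.cases_succ]
      cases r (Sum.inr i) <;> simp

theorem msubst_msubst {l : ℕ} (A : PreFormula Var arity l) :
    ∀ {m k : ℕ} (s : Var ⊕ Fin m → Var ⊕ Fin k) (r : Var ⊕ Fin l → Var ⊕ Fin m),
      (A.msubst r).msubst s = A.msubst (s ∘ r) := by
  induction A with
  | atom p t => intros; rfl
  | tensor A B hA hB => intros; simp only [msubst, hA, hB]
  | limp A B hA hB => intros; simp only [msubst, hA, hB]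
  | ex A hA => intros; simp only [msubst, hA, liftSubst_comp]
  | all A hA => intros; simp only [msubst, hA, liftSubst_comp]

theorem msubst_congr {m : ℕ} (A : PreFormula Var arity m) :
    ∀ {k : ℕ} (s r : Var ⊕ Fin m → Var ⊕ Fin k), (∀ x ∈ A.FVar, s (.inl x) = r (.inl x)) →
      (∀ i, s (.inr i) = r (.inr i)) → A.msubst s = A.msubst r := by
  induction A with
  | atom p t =>
    intro k s r h₁ h₂
    simp only [msubst, atom.injEq, heq_eq_eq, true_and]
    funext i
    rcases h : t i with x | j
    · exact h₁ x ⟨i, h⟩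
    · exact h₂ j
  | tensor A B hA hB =>
    intro k s r h₁ h₂
    simp only [msubst, hA s r (fun x hx => h₁ x (.inl hx)) h₂,
      hB s r (fun x hx => h₁ x (.inr hx)) h₂]
  | limp A B hA hB =>
    intro k s r h₁ h₂
    simp only [msubst, hA s r (fun x hx => h₁ x (.inl hx)) h₂,
      hB s r (fun x hx => h₁ x (.inr hx)) h₂]
  | ex A hA =>
    intro k s r h₁ h₂
    rw [msubst, msubst, hA (liftSubst s) (liftSubst r)]
    · intro x hx
      simp [liftSubst, h₁ x hx]
    · refine Fin.cases ?_ fun i => ?_ <;> simp [liftSubst, h₂]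
  | all A hA =>
    intro k s r h₁ h₂
    rw [msubst, msubst, hA (liftSubst s) (liftSubst r)]
    · intro x hx
      simp [liftSubst, h₁ x hx]
    · refine Fin.cases ?_ fun i => ?_ <;> simp [liftSubst, h₂]

theorem liftSubst_map (h : Var → Var) (n : ℕ) :
    liftSubst (Sum.map h id : Var ⊕ Fin n → Var ⊕ Fin n) = Sum.map h id := by
  funext x
  rcases x with x | i
  · simp [liftSubst]
  · refine Fin.cases ?_ (fun i => ?_) i <;> simp [liftSubst]

theorem subst_eq_msubst (h : Var → Var) {n : ℕ} (A : PreFormula Var arity n) :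
    A.subst h = A.msubst (Sum.map h id) := by
  induction A with
  | atom p t => rfl
  | tensor A B hA hB => simp only [subst, msubst, hA, hB]
  | limp A B hA hB => simp only [subst, msubst, hA, hB]
  | ex A hA => simp only [subst, msubst, hA, liftSubst_map]
  | all A hA => simp only [subst, msubst, hA, liftSubst_map]

theorem liftSubst_elim {m k : ℕ} (f : Fin m → Var ⊕ Fin k) :
    liftSubst (Sum.elim Sum.inl f) = Sum.elim Sum.inl (liftIdx f) := by
  funext x
  rcases x with x | i
  · simp [liftSubst]
  · refine Fin.cases ?_ (fun i => ?_) i <;> simp [liftSubst, liftIdx]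

theorem bindIdx_eq_msubst {m : ℕ} (A : PreFormula Var arity m) :
    ∀ {k : ℕ} (f : Fin m → Var ⊕ Fin k), A.bindIdx f = A.msubst (Sum.elim Sum.inl f) := by
  induction A with
  | atom p t => intros; rfl
  | tensor A B hA hB => intros; simp only [bindIdx, msubst, hA, hB]
  | limp A B hA hB => intros; simp only [bindIdx, msubst, hA, hB]
  | ex A hA => intros; simp only [bindIdx, msubst, hA, liftSubst_elim]
  | all A hA => intros; simp only [bindIdx, msubst, hA, liftSubst_elim]

theorem inst_eq_msubst (A : PreFormula Var arity 1) (y : Var) :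
    A.inst y = A.msubst (Sum.elim Sum.inl fun _ => Sum.inl y) :=
  bindIdx_eq_msubst A _

theorem subst_congr {n : ℕ} (A : PreFormula Var arity n) {h k : Var → Var}
    (hk : ∀ x ∈ A.FVar, h x = k x) : A.subst h = A.subst k := by
  rw [subst_eq_msubst, subst_eq_msubst]
  exact msubst_congr A _ _ (fun x hx => by simp [hk x hx]) fun i => rfl

theorem subst_id {n : ℕ} (A : PreFormula Var arity n) : A.subst id = A := by
  induction A with
  | atom p t => simp [subst]
  | tensor A B hA hB => simp only [subst, hA, hB]
  | limp A B hA hB => simp only [subst, hA, hB]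
  | ex A hA => simp only [subst, hA]
  | all A hA => simp only [subst, hA]

theorem subst_inst (A : PreFormula Var arity 1) (h : Var → Var) (y : Var) :
    (A.inst y).subst h = (A.subst h).inst (h y) := by
  rw [subst_eq_msubst, subst_eq_msubst, inst_eq_msubst, inst_eq_msubst, msubst_msubst,
    msubst_msubst]
  congr 1
  funext x
  rcases x with x | i <;> simp

theorem finite_FVar {n : ℕ} (A : PreFormula Var arity n) : A.FVar.Finite := by
  induction A with
  | atom p t =>
    refine (Set.finite_range fun i => Sum.elim some (fun _ => none) (t i)).preimage
      (Option.some_injective _).injOn |>.subset ?_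
    rintro x ⟨i, hi⟩
    exact ⟨i, by simp [hi]⟩
  | tensor A B hA hB => exact hA.union hB
  | limp A B hA hB => exact hA.union hB
  | ex A hA => exact hA
  | all A hA => exact hA

/-- The assignment of variables to free variables and dangling indices which extends `e` by
assigning `y` to the index of one more binder. -/
def envCons {n : ℕ} (e : Var ⊕ Fin n → Var) (y : Var) : Var ⊕ Fin (n + 1) → Var :=
  Sum.elim (fun x => e (.inl x)) (Fin.cases y fun i => e (.inr i))

/-- The formula obtained by replacing the free variables and the dangling indices by variables as
prescribed by `e`. -/
def ground {n : ℕ} (e : Var ⊕ Fin n → Var) (A : PreFormula Var arity n) : Formula Var arity :=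
  A.msubst (Sum.inl ∘ e)

theorem envCons_comp_liftSubst {m k : ℕ} (s : Var ⊕ Fin m → Var ⊕ Fin k)
    (e : Var ⊕ Fin k → Var) (y : Var) : envCons e y ∘ liftSubst s = envCons (e ∘ s) y := by
  funext x
  rcases x with x | i
  · simp only [liftSubst, envCons, Function.comp, Sum.elim_inl]
    cases s (Sum.inl x) <;> simp
  · refine Fin.cases ?_ (fun i => ?_) i
    · simp [liftSubst, envCons]
    · simp only [liftSubst, envCons, Function.comp, Sum.elim_inr, Fin.cases_succ]
      cases s (Sum.inr i) <;> simp

theorem comp_envCons {n : ℕ} (h : Var → Var) (e : Var ⊕ Fin n → Var) (y : Var) :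
    h ∘ envCons e y = envCons (h ∘ e) (h y) := by
  funext x
  rcases x with x | i
  · rfl
  · refine Fin.cases ?_ (fun i => ?_) i <;> rfl

theorem subst_ground {n : ℕ} (A : PreFormula Var arity n) (k : Var → Var)
    (e : Var ⊕ Fin n → Var) : (A.ground e).subst k = A.ground (k ∘ e) := by
  rw [ground, ground, subst_eq_msubst, msubst_msubst]
  rfl

theorem ground_congr {n : ℕ} (A : PreFormula Var arity n) {e e' : Var ⊕ Fin n → Var}
    (h₁ : ∀ x ∈ A.FVar, e (.inl x) = e' (.inl x)) (h₂ : ∀ i, e (.inr i) = e' (.inr i)) :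
    A.ground e = A.ground e' :=
  msubst_congr A _ _ (fun x hx => congrArg Sum.inl (h₁ x hx)) fun i => congrArg Sum.inl (h₂ i)

theorem inst_msubst_liftSubst {n : ℕ} (A : PreFormula Var arity (n + 1)) (e : Var ⊕ Fin n → Var)
    (y : Var) : (A.msubst (liftSubst (Sum.inl ∘ e))).inst y = A.ground (envCons e y) := by
  rw [inst_eq_msubst, msubst_msubst, ground]
  congr 1
  funext x
  rcases x with x | i
  · simp [liftSubst, envCons]
  · refine Fin.cases ?_ (fun i => ?_) i <;> simp [liftSubst, envCons]

end PreFormula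

end MILL

/-! ### Parallel composition up to isomorphism -/

namespace MILL

open PreFormula

namespace LabHypergraph

variable {Var : Type} {T : Type*} {type : T → Finset Var}

theorem par_ext_eq_some {H K : LabHypergraph type} {σ : Var} {x : (H.par K).V}
    (hx : (H.par K).ext σ = some x) :
    (∃ v, H.ext σ = some v ∧ x = Quot.mk _ (Sum.inl v)) ∨
      ∃ w, K.ext σ = some w ∧ x = Quot.mk _ (Sum.inr w) := by
  cases hH : H.ext σ with
  | some v =>
    rw [par_ext_left H K hH] at hx
    exact .inl ⟨v, rfl, (Option.some.inj hx).symm⟩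
  | none =>
    cases hK : K.ext σ with
    | some w =>
      rw [par_ext_right H K hK] at hx
      exact .inr ⟨w, rfl, (Option.some.inj hx).symm⟩
    | none => simp [par, hH, hK] at hx

theorem par_ext_eq_none {H K : LabHypergraph type} {σ : Var} :
    (H.par K).ext σ = none ↔ H.ext σ = none ∧ K.ext σ = none := by
  simp [par, Option.or_eq_none_iff]

theorem par_glue {H K : LabHypergraph type} {σ : Var} {v : H.V} {w : K.V}
    (hv : H.ext σ = some v) (hw : K.ext σ = some w) :
    (Quot.mk _ (Sum.inl v) : (H.par K).V) = Quot.mk _ (Sum.inr w) :=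
  Quot.sound ⟨σ, v, w, hv, hw, rfl, rfl⟩

/-- Maps on nodes of `H` and `K` that agree on nodes with a common selector define a map on the
nodes of the parallel composition. -/
def parLift {H K : LabHypergraph type} {X : Type*} (f : H.V → X) (g : K.V → X)
    (hfg : ∀ σ v w, H.ext σ = some v → K.ext σ = some w → f v = g w) : (H.par K).V → X :=
  Quot.lift (Sum.elim f g) (by
    rintro _ _ ⟨σ, v, w, hv, hw, rfl, rfl⟩
    exact hfg σ v w hv hw)

theorem Iso.refl (H : LabHypergraph type) : Iso H H :=
  ⟨Equiv.refl _, Equiv.refl _, fun _ => rfl, fun _ _ _ _ => rfl, fun σ => by simp⟩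

theorem Iso.symm {H K : LabHypergraph type} (i : Iso H K) : Iso K H := by
  obtain ⟨f, g, hl, ha, he⟩ := i
  refine ⟨f.symm, g.symm, fun e => ?_, fun e σ h₁ h₂ => ?_, fun σ => ?_⟩
  · simpa using (hl (g.symm e)).symm
  · obtain ⟨e, rfl⟩ := g.surjective e
    revert h₂
    rw [g.symm_apply_apply]
    intro h₂
    rw [ha e σ h₂ h₁, f.symm_apply_apply]
  · simp [he σ, Option.map_map]

theorem Iso.trans {H K L : LabHypergraph type} (i : Iso H K) (j : Iso K L) : Iso H L := by
  obtain ⟨f, g, hl, ha, he⟩ := i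
  obtain ⟨f', g', hl', ha', he'⟩ := j
  refine ⟨f.trans f', g.trans g', fun e => ?_, fun e σ h₁ h₂ => ?_, fun σ => ?_⟩
  · simp [hl, hl']
  · have h : σ ∈ type (K.lab (g e)) := by rwa [hl]
    simp only [Equiv.trans_apply]
    rw [ha' (g e) σ h h₂, ha e σ h₁ h]
  · simp [he, he', Option.map_map, Function.comp_def]

theorem Iso.par {H H' K K' : LabHypergraph type} (i : Iso H H') (j : Iso K K') :
    Iso (H.par K) (H'.par K') := by
  obtain ⟨f, g, hl, ha, he⟩ := i
  obtain ⟨f', g', hl', ha', he'⟩ := j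
  refine ⟨Quot.congr (f.sumCongr f') ?_, g.sumCongr g', ?_, ?_, fun σ => ?_⟩
  · intro x y
    constructor
    · rintro ⟨σ, a, b, ha, hb, rfl, rfl⟩
      exact ⟨σ, f a, f' b, by simp [he, ha], by simp [he', hb], rfl, rfl⟩
    · rintro ⟨σ, a, b, ha, hb, hx, hy⟩
      simp only [he, he', Option.map_eq_some_iff] at ha hb
      obtain ⟨a, ha, rfl⟩ := ha
      obtain ⟨b, hb, rfl⟩ := hb
      refine ⟨σ, a, b, ha, hb, (f.sumCongr f').injective ?_, (f.sumCongr f').injective ?_⟩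
      · rw [hx]; rfl
      · rw [hy]; rfl
  · rintro (e | e)
    · exact hl e
    · exact hl' e
  · rintro (e | e) σ h₁ h₂
    · exact congrArg (Quot.mk _) (congrArg Sum.inl (ha e σ h₁ h₂))
    · exact congrArg (Quot.mk _) (congrArg Sum.inr (ha' e σ h₁ h₂))
  · simp only [LabHypergraph.par, he, he', Option.map_or, Option.map_map]
    rfl

theorem Iso.par_comm (H K : LabHypergraph type) : Iso (H.par K) (K.par H) := by
  refine ⟨⟨parLift (fun v => Quot.mk _ (.inr v)) (fun v => Quot.mk _ (.inl v)) ?_,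
      parLift (fun v => Quot.mk _ (.inr v)) (fun v => Quot.mk _ (.inl v)) ?_, ?_, ?_⟩,
    Equiv.sumComm _ _, ?_, ?_, ?_⟩
  · exact fun σ v w hv hw => (par_glue hw hv).symm
  · exact fun σ v w hv hw => (par_glue hw hv).symm
  · rintro ⟨_ | _⟩ <;> rfl
  · rintro ⟨_ | _⟩ <;> rfl
  · rintro (e | e) <;> rfl
  · rintro (e | e) σ h₁ h₂ <;> rfl
  · intro σ
    cases hH : H.ext σ with
    | none =>
      cases hK : K.ext σ with
      | none => rw [par_ext_eq_none.2 ⟨hK, hH⟩, par_ext_eq_none.2 ⟨hH, hK⟩, Option.map_none]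
      | some w =>
        rw [par_ext_left K H hK, par_ext_right H K hK]
        rfl
    | some v =>
      rw [par_ext_right K H hH, par_ext_left H K hH]
      rfl

theorem Iso.par_assoc (H K L : LabHypergraph type) :
    Iso ((H.par K).par L) (H.par (K.par L)) := by
  refine ⟨⟨parLift (parLift (fun v => Quot.mk _ (.inl v))
        (fun v => Quot.mk _ (.inr (Quot.mk _ (.inl v)))) ?_)
        (fun v => Quot.mk _ (.inr (Quot.mk _ (.inr v)))) ?_,
      parLift (fun v => Quot.mk _ (.inl (Quot.mk _ (.inl v))))
        (parLift (fun v => Quot.mk _ (.inl (Quot.mk _ (.inr v)))) (fun v => Quot.mk _ (.inr v)) ?_)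
        ?_, ?_, ?_⟩, Equiv.sumAssoc _ _ _, ?_, ?_, ?_⟩
  · intro σ v w hv hw
    exact par_glue hv (par_ext_left _ _ hw)
  · intro σ v w hv hw
    rcases par_ext_eq_some hv with ⟨v, hv', rfl⟩ | ⟨v, hv', rfl⟩
    · exact par_glue hv' (par_ext_right _ _ hw)
    · exact congrArg (Quot.mk _) (congrArg Sum.inr (par_glue hv' hw))
  · intro σ v w hv hw
    exact par_glue (par_ext_right _ _ hv) hw
  · intro σ v w hv hw
    rcases par_ext_eq_some hw with ⟨w, hw', rfl⟩ | ⟨w, hw', rfl⟩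
    · exact congrArg (Quot.mk _) (congrArg Sum.inl (par_glue hv hw'))
    · exact par_glue (par_ext_left _ _ hv) hw'
  · rintro ⟨⟨⟨_ | _⟩⟩ | _⟩ <;> rfl
  · rintro ⟨_ | ⟨⟨_ | _⟩⟩⟩ <;> rfl
  · rintro ((e | e) | e) <;> rfl
  · rintro ((e | e) | e) σ h₁ h₂ <;> rfl
  · intro σ
    simp only [LabHypergraph.par, Option.map_or, Option.map_map, Option.or_assoc]
    rfl

theorem Iso.empty_par (H : LabHypergraph type) : Iso ((empty type).par H) H := by
  refine ⟨⟨parLift Empty.elim id ?_, fun v => Quot.mk _ (.inr v), ?_, fun _ => rfl⟩,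
    Equiv.emptySum Empty _, ?_, ?_, ?_⟩
  · intro σ v; exact v.elim
  · rintro ⟨v | v⟩
    · exact v.elim
    · rfl
  · rintro (e | e)
    · exact e.elim
    · rfl
  · rintro (e | e) σ h₁ h₂
    · exact e.elim
    · rfl
  · intro σ
    simp only [LabHypergraph.par, LabHypergraph.empty, Option.map_none, Option.none_or,
      Option.map_map]
    cases H.ext σ <;> rfl

/-- Sets of abstract hypergraphs: sets of hypergraphs closed under isomorphism. -/
def IsoClosed (L : Set (LabHypergraph type)) : Prop :=
  ∀ H K, Iso H K → H ∈ L → K ∈ L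

theorem isoClosed_langPar (L M : Set (LabHypergraph type)) : IsoClosed (langPar L M) := by
  rintro H K i ⟨H₁, h₁, H₂, h₂, j⟩
  exact ⟨H₁, h₁, H₂, h₂, j.trans i⟩

theorem langPar_mono {L L' M M' : Set (LabHypergraph type)} (hL : L ⊆ L') (hM : M ⊆ M') :
    langPar L M ⊆ langPar L' M' := by
  rintro K ⟨H₁, h₁, H₂, h₂, i⟩
  exact ⟨H₁, hL h₁, H₂, hM h₂, i⟩

theorem langPar_comm (L M : Set (LabHypergraph type)) : langPar L M = langPar M L := by
  ext K
  constructor <;>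
  · rintro ⟨H₁, h₁, H₂, h₂, i⟩
    exact ⟨H₂, h₂, H₁, h₁, (Iso.par_comm _ _).trans i⟩

theorem langPar_assoc (L M N : Set (LabHypergraph type)) :
    langPar (langPar L M) N = langPar L (langPar M N) := by
  ext K
  constructor
  · rintro ⟨H, ⟨H₁, h₁, H₂, h₂, i⟩, H₃, h₃, j⟩
    exact ⟨H₁, h₁, _, ⟨H₂, h₂, H₃, h₃, Iso.refl _⟩,
      ((Iso.par_assoc _ _ _).symm.trans (i.par (Iso.refl _))).trans j⟩
  · rintro ⟨H₁, h₁, H, ⟨H₂, h₂, H₃, h₃, i⟩, j⟩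
    exact ⟨_, ⟨H₁, h₁, H₂, h₂, Iso.refl _⟩, H₃, h₃,
      ((Iso.par_assoc _ _ _).trans ((Iso.refl _).par i)).trans j⟩

theorem langPar_left_comm (L M N : Set (LabHypergraph type)) :
    langPar L (langPar M N) = langPar M (langPar L N) := by
  rw [← langPar_assoc, langPar_comm L M, langPar_assoc]

theorem empty_langPar {L : Set (LabHypergraph type)} (hL : IsoClosed L) :
    langPar {K | Iso (empty type) K} L = L := by
  ext K
  constructor
  · rintro ⟨H₁, h₁, H₂, h₂, i⟩
    exact hL _ _ ((Iso.empty_par H₂).symm.trans ((Iso.par h₁ (Iso.refl _)).trans i)) h₂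
  · intro hK
    exact ⟨_, Iso.refl _, K, hK, Iso.empty_par K⟩

end LabHypergraph

open LabHypergraph

/-! ### Soundness -/

namespace HypergraphLanguageModel

variable {Var Pred : Type} {arity : Pred → ℕ} {T : Type*} {type : T → Finset Var}
  (M : HypergraphLanguageModel arity type)

theorem isoClosed_antecedent (Γ : List (Formula Var arity)) : IsoClosed (M.antecedent Γ) := by
  cases Γ with
  | nil => exact fun H K i h => h.trans i
  | cons A Γ => exact isoClosed_langPar _ _

theorem antecedent_append (Γ Δ : List (Formula Var arity)) :
    M.antecedent (Γ ++ Δ) = langPar (M.antecedent Γ) (M.antecedent Δ) := by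
  induction Γ with
  | nil => exact (empty_langPar (M.isoClosed_antecedent Δ)).symm
  | cons A Γ ih =>
    change langPar _ (M.antecedent (Γ ++ Δ)) = langPar (langPar _ _) _
    rw [ih, langPar_assoc]

theorem antecedent_perm {Γ Δ : List (Formula Var arity)} (h : Γ.Perm Δ) :
    M.antecedent Γ = M.antecedent Δ := by
  induction h with
  | nil => rfl
  | cons A _ ih => simp only [antecedent, ih]
  | swap A B Γ => exact langPar_left_comm _ _ _
  | trans _ _ ih₁ ih₂ => exact ih₁.trans ih₂

/-- The parallel composition of the languages of the formulas of a multiset. -/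
def interp (Γ : Multiset (Formula Var arity)) : Set (LabHypergraph type) :=
  Quot.liftOn Γ M.antecedent fun _ _ h => M.antecedent_perm h

theorem interp_cons (A : Formula Var arity) (Γ : Multiset (Formula Var arity)) :
    M.interp (A ::ₘ Γ) = langPar (M.u A) (M.interp Γ) :=
  Quot.inductionOn Γ fun _ => rfl

theorem interp_add (Γ Δ : Multiset (Formula Var arity)) :
    M.interp (Γ + Δ) = langPar (M.interp Γ) (M.interp Δ) :=
  Quotient.inductionOn₂ Γ Δ fun _ _ => M.antecedent_append _ _

theorem interp_singleton (A : Formula Var arity) : M.interp {A} = M.u A :=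
  (langPar_comm _ _).trans (empty_langPar fun H K => M.iso_closed A H K)

theorem langPar_limp_subset (A B : Formula Var arity) :
    langPar (M.u (limp A B)) (M.u A) ⊆ M.u B := by
  rintro K ⟨H, hH, H', hH', i⟩
  rw [M.limp_eq] at hH
  exact M.iso_closed _ _ _ i (hH H' hH')

/-- Truth of a derivable sequent is proved for all its substitution instances at once: the
eigenvariable of a quantifier rule is then specialised by changing the substitution. -/
theorem interp_subset_of_derivable {Γ : Multiset (Formula Var arity)} {C : Formula Var arity}
    (d : Derivable Γ C) :
    ∀ h : Var → Var, M.interp (Γ.map (PreFormula.subst h)) ⊆ M.u (C.subst h) := by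
  classical
  induction d with
  | ax A => intro h; simp [interp_singleton]
  | @tensorL Γ A B C _ ih =>
    intro h
    have := ih h
    simp only [Multiset.map_cons, interp_cons] at this ⊢
    rwa [PreFormula.subst, M.tensor_eq, langPar_assoc]
  | tensorR _ _ ih₁ ih₂ =>
    intro h
    rw [Multiset.map_add, interp_add, PreFormula.subst, M.tensor_eq]
    exact langPar_mono (ih₁ h) (ih₂ h)
  | @limpL Γ Δ A B C _ _ ih₁ ih₂ =>
    intro h
    have := ih₂ h
    simp only [Multiset.map_cons, interp_cons, Multiset.map_add, interp_add] at this ⊢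
    refine subset_trans ?_ this
    rw [langPar_comm (M.interp (Γ.map _)), ← langPar_assoc]
    refine langPar_mono (subset_trans (langPar_mono subset_rfl (ih₁ h)) ?_) subset_rfl
    exact M.langPar_limp_subset _ _
  | @limpR Γ A B _ ih =>
    intro h H hH
    rw [PreFormula.subst, M.limp_eq]
    intro H' hH'
    have := ih h
    rw [Multiset.map_cons, interp_cons, langPar_comm] at this
    exact this ⟨H, hH, H', hH', Iso.refl _⟩
  | @exL Γ A B z hΓ hA hB _ ih =>
    intro h
    rw [Multiset.map_cons, interp_cons, PreFormula.subst, M.ex_eq]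
    rintro K ⟨H, hH, H', hH', i⟩
    obtain ⟨y, hy⟩ := Set.mem_iUnion.1 hH
    have key := ih (Function.update h z y)
    have agree : ∀ {n : ℕ} (D : PreFormula Var arity n), z ∉ D.FVar →
        D.subst (Function.update h z y) = D.subst h := fun D hD =>
      subst_congr D fun x hx => Function.update_of_ne (by rintro rfl; exact hD hx) _ _
    rw [Multiset.map_cons, interp_cons, subst_inst, agree A hA, Function.update_self, agree B hB,
      Multiset.map_congr rfl fun D hD => agree D (hΓ D hD)] at key
    exact key ⟨H, hy, H', hH', i⟩
  | @exR Γ A y _ ih =>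
    intro h
    rw [PreFormula.subst, M.ex_eq]
    refine (ih h).trans ?_
    rw [subst_inst]
    exact Set.subset_iUnion (fun y => M.u ((A.subst h).inst y)) (h y)
  | @allL Γ A B y _ ih =>
    intro h
    have := ih h
    rw [Multiset.map_cons, interp_cons] at this ⊢
    refine subset_trans (langPar_mono ?_ subset_rfl) this
    rw [PreFormula.subst, M.all_eq, subst_inst]
    exact Set.iInter_subset (fun y => M.u ((A.subst h).inst y)) (h y)
  | @allR Γ A z hΓ hA _ ih =>
    intro h
    rw [PreFormula.subst, M.all_eq]
    refine Set.subset_iInter fun y => ?_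
    have key := ih (Function.update h z y)
    have agree : ∀ {n : ℕ} (D : PreFormula Var arity n), z ∉ D.FVar →
        D.subst (Function.update h z y) = D.subst h := fun D hD =>
      subst_congr D fun x hx => Function.update_of_ne (by rintro rfl; exact hD hx) _ _
    rwa [subst_inst, agree A hA, Function.update_self,
      Multiset.map_congr rfl fun D hD => agree D (hΓ D hD)] at key

theorem holds_of_derivable {Γ : List (Formula Var arity)} {B : Formula Var arity}
    (d : Derivable (Γ : Multiset (Formula Var arity)) B) : M.Holds Γ B := by
  have := M.interp_subset_of_derivable d id
  rwa [subst_id, Multiset.map_congr rfl fun D _ => subst_id D, Multiset.map_id'] at this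

end HypergraphLanguageModel

end MILL

/-! ### Fusions of external nodes -/

namespace MILL

open PreFormula

namespace LabHypergraph

variable {Var : Type} {T : Type*} {type : T → Finset Var}

/-- The hypergraph has only finitely many selectors. -/
def FiniteType (H : LabHypergraph type) : Prop :=
  {σ | ∃ v, H.ext σ = some v}.Finite

theorem finiteType_par {H K : LabHypergraph type} :
    (H.par K).FiniteType ↔ H.FiniteType ∧ K.FiniteType := by
  rw [FiniteType, FiniteType, FiniteType, ← Set.finite_union]
  refine iff_of_eq (congrArg _ ?_)
  ext σ
  constructor
  · rintro ⟨x, hx⟩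
    rcases par_ext_eq_some hx with ⟨v, hv, -⟩ | ⟨v, hv, -⟩
    exacts [.inl ⟨v, hv⟩, .inr ⟨v, hv⟩]
  · rintro (⟨v, hv⟩ | ⟨v, hv⟩)
    exacts [⟨_, par_ext_left _ _ hv⟩, ⟨_, par_ext_right _ _ hv⟩]

theorem Iso.finiteType {H K : LabHypergraph type} (i : Iso H K) (hH : H.FiniteType) :
    K.FiniteType := by
  obtain ⟨f, -, -, -, he⟩ := i
  refine hH.subset ?_
  rintro σ ⟨v, hv⟩
  rw [he, Option.map_eq_some_iff] at hv
  exact ⟨_, hv.choose_spec.1⟩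

theorem sub_ext_eq_some {h : Var → Var} {H : LabHypergraph type} {τ : Var} {x : (H.sub h).V}
    (hx : (H.sub h).ext τ = some x) : ∃ σ v, h σ = τ ∧ H.ext σ = some v ∧ x = Quot.mk _ v := by
  by_cases hτ : ∃ (v : H.V) (σ : Var), h σ = τ ∧ H.ext σ = some v
  · obtain ⟨v, σ, rfl, hv⟩ := hτ
    rw [sub_ext h H hv] at hx
    exact ⟨σ, v, rfl, hv, (Option.some.inj hx).symm⟩
  · simp [sub, hτ] at hx

theorem FiniteType.sub {H : LabHypergraph type} (hH : H.FiniteType) (h : Var → Var) :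
    (H.sub h).FiniteType := by
  refine (hH.image h).subset ?_
  rintro τ ⟨x, hx⟩
  obtain ⟨σ, v, rfl, hv, -⟩ := sub_ext_eq_some hx
  exact ⟨σ, ⟨v, hv⟩, rfl⟩

/-- The nodes identified by a parallel composition become external. -/
theorem eq_or_ext_of_par_mk_eq {H K : LabHypergraph type} {x y : H.V ⊕ K.V}
    (hxy : (Quot.mk _ x : (H.par K).V) = Quot.mk _ y) :
    x = y ∨ ∃ τ, (H.par K).ext τ = some (Quot.mk _ x) := by
  have := Quot.eqvGen_exact hxy
  clear hxy
  induction this with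
  | rel x y r =>
    obtain ⟨σ, v, w, hv, hw, rfl, rfl⟩ := r
    exact .inr ⟨σ, par_ext_left _ _ hv⟩
  | refl x => exact .inl rfl
  | symm x y r ih =>
    rcases ih with rfl | ⟨τ, hτ⟩
    · exact .inl rfl
    · exact .inr ⟨τ, by rw [hτ, Quot.eqvGen_sound r]⟩
  | trans x y z r _ ih₁ ih₂ =>
    rcases ih₁ with rfl | h
    · exact ih₂
    · exact .inr h

theorem eq_or_ext_of_sub_mk_eq {h : Var → Var} {H : LabHypergraph type} {x y : H.V}
    (hxy : (Quot.mk _ x : (H.sub h).V) = Quot.mk _ y) :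
    x = y ∨ ∃ τ, (H.sub h).ext τ = some (Quot.mk _ x) := by
  have := Quot.eqvGen_exact hxy
  clear hxy
  induction this with
  | rel x y r =>
    obtain ⟨σ, τ, -, hv, -⟩ := r
    exact .inr ⟨h σ, sub_ext h H hv⟩
  | refl x => exact .inl rfl
  | symm x y r ih =>
    rcases ih with rfl | ⟨τ, hτ⟩
    · exact .inl rfl
    · exact .inr ⟨τ, by rw [hτ, Quot.eqvGen_sound r]⟩
  | trans x y z r _ ih₁ ih₂ =>
    rcases ih₁ with rfl | h
    · exact ih₂
    · exact .inr h

/-- The external node with selector `τ` if there is one, and otherwise `τ` itself, thought of as a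
virtual isolated external node. -/
def extNode (K : LabHypergraph type) (τ : Var) : K.V ⊕ Var :=
  (K.ext τ).elim (Sum.inr τ) Sum.inl

theorem extNode_of_some {K : LabHypergraph type} {τ : Var} {v : K.V} (hv : K.ext τ = some v) :
    K.extNode τ = Sum.inl v := by
  simp [extNode, hv]

theorem extNode_of_none {K : LabHypergraph type} {τ : Var} (hv : K.ext τ = none) :
    K.extNode τ = Sum.inr τ := by
  simp [extNode, hv]

theorem extNode_eq_inl {K : LabHypergraph type} {τ : Var} {v : K.V} :
    K.extNode τ = Sum.inl v ↔ K.ext τ = some v := by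
  cases h : K.ext τ <;> simp [extNode, h]

/-- The maps `f` on nodes and `b` on hyperedges turn `H` into `K` by renaming selectors along `h`,
identifying nodes, and adding nodes and selectors, where all nodes with several preimages have to be
external in `K`. Isolated external nodes of `H` may disappear: they are mapped to virtual nodes. -/
structure IsFusion (h : Var → Var) (H K : LabHypergraph type) (f : H.V → K.V ⊕ Var)
    (b : H.E ≃ K.E) : Prop where
  lab : ∀ e, K.lab (b e) = H.lab e
  att : ∀ e σ (h₁ : σ ∈ type (H.lab e)) (h₂ : σ ∈ type (K.lab (b e))),
    f (H.att e ⟨σ, h₁⟩) = Sum.inl (K.att (b e) ⟨σ, h₂⟩)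
  ext : ∀ σ v, H.ext σ = some v → f v = K.extNode (h σ)
  glue : ∀ v w u, f v = Sum.inl u → f w = Sum.inl u → v = w ∨ ∃ τ, K.ext τ = some u

/-- `K` arises from `H` by a fusion along `h`. -/
def Fuses (h : Var → Var) (H K : LabHypergraph type) : Prop :=
  ∃ f b, IsFusion h H K f b

theorem Fuses.of_iso {H K : LabHypergraph type} (i : Iso H K) : Fuses id H K := by
  obtain ⟨f, b, hl, ha, he⟩ := i
  refine ⟨fun v => .inl (f v), b, hl, fun e σ h₁ h₂ => congrArg _ (ha e σ h₁ h₂).symm,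
    fun σ v hv => ?_, fun v w u hv hw => .inl ?_⟩
  · exact (extNode_of_some (by simp [he, hv])).symm
  · exact f.injective (Sum.inl_injective (hv.trans hw.symm))

theorem Fuses.iso_left {h : Var → Var} {H H' K : LabHypergraph type} (i : Iso H H')
    (F : Fuses h H' K) : Fuses h H K := by
  obtain ⟨f, b, hl, ha, he⟩ := i
  obtain ⟨f', b', F⟩ := F
  refine ⟨f' ∘ f, b.trans b', fun e => (F.lab _).trans (hl e), fun e σ h₁ h₂ => ?_,
    fun σ v hv => ?_, fun v w u hv hw => ?_⟩
  · have h₃ : σ ∈ type (H'.lab (b e)) := by rwa [hl]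
    rw [Function.comp_apply, ← ha e σ h₁ h₃]
    exact F.att (b e) σ h₃ h₂
  · exact F.ext σ (f v) (by simp [he, hv])
  · exact (F.glue _ _ u hv hw).imp_left fun h => f.injective h

theorem Fuses.iso_right {h : Var → Var} {H K K' : LabHypergraph type} (F : Fuses h H K)
    (i : Iso K K') : Fuses h H K' := by
  obtain ⟨f, b, hl, ha, he⟩ := i
  obtain ⟨f', b', F⟩ := F
  refine ⟨fun v => (f' v).map f id, b'.trans b, fun e => (hl _).trans (F.lab e),
    fun e σ h₁ h₂ => ?_, fun σ v hv => ?_, fun v w u hv hw => ?_⟩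
  · have h₃ : σ ∈ type (K.lab (b' e)) := by rwa [F.lab]
    rw [F.att e σ h₁ h₃, Sum.map_inl, ← ha (b' e) σ h₃ h₂]
    rfl
  · rw [F.ext σ v hv]
    cases hK : K.ext (h σ) with
    | none => rw [extNode_of_none hK, extNode_of_none (by simp [he, hK])]; rfl
    | some w => rw [extNode_of_some hK, extNode_of_some (v := f w) (by simp [he, hK])]; rfl
  · cases hv' : f' v with
    | inr τ => simp [hv'] at hv
    | inl a =>
      cases hw' : f' w with
      | inr τ => simp [hw'] at hw
      | inl c =>
        simp only [hv', hw', Sum.map_inl, Sum.inl.injEq] at hv hw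
        obtain rfl : a = c := f.injective (hv.trans hw.symm)
        refine (F.glue v w a hv' hw').imp_right fun ⟨τ, hτ⟩ => ⟨τ, ?_⟩
        simp [he, hτ, hv]

theorem Fuses.sub (h : Var → Var) (H : LabHypergraph type) : Fuses h H (H.sub h) := by
  refine ⟨fun v => .inl (Quot.mk _ v), Equiv.refl _, fun _ => rfl, fun _ _ _ _ => rfl,
    fun σ v hv => (extNode_of_some (sub_ext h H hv)).symm, fun v w u hv hw => ?_⟩
  cases Sum.inl_injective hv
  exact eq_or_ext_of_sub_mk_eq (Sum.inl_injective hw).symm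

theorem elim_extNode_left (K K' : LabHypergraph type) (τ : Var) :
    Sum.elim (fun v => .inl (Quot.mk _ (.inl v))) (K.par K').extNode (K.extNode τ) =
      (K.par K').extNode τ := by
  cases hK : K.ext τ with
  | none => rw [extNode_of_none hK, Sum.elim_inr]
  | some v => rw [extNode_of_some hK, extNode_of_some (par_ext_left K K' hK), Sum.elim_inl]

theorem elim_extNode_right (K K' : LabHypergraph type) (τ : Var) :
    Sum.elim (fun v => .inl (Quot.mk _ (.inr v))) (K.par K').extNode (K'.extNode τ) =
      (K.par K').extNode τ := by
  cases hK : K'.ext τ with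
  | none => rw [extNode_of_none hK, Sum.elim_inr]
  | some v => rw [extNode_of_some hK, extNode_of_some (par_ext_right K K' hK), Sum.elim_inl]

theorem Fuses.par {h : Var → Var} {H K H' K' : LabHypergraph type} (F : Fuses h H K)
    (F' : Fuses h H' K') : Fuses h (H.par H') (K.par K') := by
  obtain ⟨f, b, F⟩ := F
  obtain ⟨f', b', F'⟩ := F'
  let j : K.V ⊕ Var → (K.par K').V ⊕ Var :=
    Sum.elim (fun v => .inl (Quot.mk _ (.inl v))) (K.par K').extNode
  let j' : K'.V ⊕ Var → (K.par K').V ⊕ Var :=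
    Sum.elim (fun v => .inl (Quot.mk _ (.inr v))) (K.par K').extNode
  -- Nodes mapped to virtual nodes are external whenever these become actual ones.
  have hj : ∀ x u, j x = .inl u → (∃ a, x = .inl a ∧ u = Quot.mk _ (.inl a)) ∨
      ∃ τ, (K.par K').ext τ = some u := by
    rintro (a | τ) u hu
    · exact .inl ⟨a, rfl, (Sum.inl_injective hu).symm⟩
    · exact .inr ⟨τ, extNode_eq_inl.1 hu⟩
  have hj' : ∀ x u, j' x = .inl u → (∃ a, x = .inl a ∧ u = Quot.mk _ (.inr a)) ∨
      ∃ τ, (K.par K').ext τ = some u := by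
    rintro (a | τ) u hu
    · exact .inl ⟨a, rfl, (Sum.inl_injective hu).symm⟩
    · exact .inr ⟨τ, extNode_eq_inl.1 hu⟩
  refine ⟨parLift (fun v => j (f v)) (fun v => j' (f' v)) ?_, b.sumCongr b', ?_, ?_, ?_, ?_⟩
  · intro σ v w hv hw
    rw [F.ext σ v hv, F'.ext σ w hw]
    exact (elim_extNode_left K K' _).trans (elim_extNode_right K K' _).symm
  · rintro (e | e)
    exacts [F.lab e, F'.lab e]
  · rintro (e | e) σ h₁ h₂
    · exact congrArg j (F.att e σ h₁ h₂)
    · exact congrArg j' (F'.att e σ h₁ h₂)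
  · intro σ x hx
    rcases par_ext_eq_some hx with ⟨v, hv, rfl⟩ | ⟨v, hv, rfl⟩
    · exact (congrArg j (F.ext σ v hv)).trans (elim_extNode_left K K' _)
    · exact (congrArg j' (F'.ext σ v hv)).trans (elim_extNode_right K K' _)
  · rintro ⟨v | v⟩ ⟨w | w⟩ u hv hw
    · rcases hj _ _ hv with ⟨a, ha, rfl⟩ | h
      · rcases hj _ _ hw with ⟨c, hc, hac⟩ | h
        · rcases eq_or_ext_of_par_mk_eq hac with hac | h
          · cases hac
            rcases F.glue v w a ha hc with rfl | ⟨τ, hτ⟩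
            · exact .inl rfl
            · exact .inr ⟨τ, par_ext_left _ _ hτ⟩
          · exact .inr h
        · exact .inr h
      · exact .inr h
    · rcases hj _ _ hv with ⟨a, ha, rfl⟩ | h
      · rcases hj' _ _ hw with ⟨c, hc, hac⟩ | h
        · exact .inr ((eq_or_ext_of_par_mk_eq hac).resolve_left nofun)
        · exact .inr h
      · exact .inr h
    · rcases hj' _ _ hv with ⟨a, ha, rfl⟩ | h
      · rcases hj _ _ hw with ⟨c, hc, hac⟩ | h
        · exact .inr ((eq_or_ext_of_par_mk_eq hac).resolve_left nofun)
        · exact .inr h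
      · exact .inr h
    · rcases hj' _ _ hv with ⟨a, ha, rfl⟩ | h
      · rcases hj' _ _ hw with ⟨c, hc, hac⟩ | h
        · rcases eq_or_ext_of_par_mk_eq hac with hac | h
          · cases hac
            rcases F'.glue v w a ha hc with rfl | ⟨τ, hτ⟩
            · exact .inl rfl
            · exact .inr ⟨τ, par_ext_right _ _ hτ⟩
          · exact .inr h
        · exact .inr h
      · exact .inr h

/-! ### Splitting a hypergraph -/

open Classical in
/-- The subhypergraph with the nodes `P` and the hyperedges `Q`. -/
noncomputable def restr (K : LabHypergraph type) (P : Set K.V) (Q : Set K.E)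
    (hPQ : ∀ e ∈ Q, ∀ σ, K.att e σ ∈ P) : LabHypergraph type where
  V := P
  E := Q
  finV := by
    have := K.finV
    infer_instance
  finE := by
    have := K.finE
    infer_instance
  lab e := K.lab e
  att e σ := ⟨K.att e σ, hPQ e e.2 σ⟩
  ext σ := (K.ext σ).bind fun v => if hv : v ∈ P then some ⟨v, hv⟩ else none

theorem restr_ext_eq_some {K : LabHypergraph type} {P : Set K.V} {Q : Set K.E}
    {hPQ : ∀ e ∈ Q, ∀ σ, K.att e σ ∈ P} {σ : Var} {v : P} :
    (K.restr P Q hPQ).ext σ = some v ↔ K.ext σ = some (v : K.V) := by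
  obtain ⟨v, hv⟩ := v
  cases hK : K.ext σ with
  | none => simp [restr, hK]
  | some w =>
    by_cases hw : w ∈ P
    · simp [restr, hK, hw]
    · simp only [restr, hK, Option.bind_some, dif_neg hw, Option.some.injEq, reduceCtorEq,
        false_iff]
      rintro rfl
      exact hw hv

theorem FiniteType.restr {K : LabHypergraph type} (hK : K.FiniteType) {P : Set K.V} {Q : Set K.E}
    {hPQ : ∀ e ∈ Q, ∀ σ, K.att e σ ∈ P} : (K.restr P Q hPQ).FiniteType := by
  refine hK.subset ?_
  rintro σ ⟨(v : P), hv⟩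
  exact ⟨v, restr_ext_eq_some.1 hv⟩

/-- A hypergraph is the parallel composition of two complementary subhypergraphs all of whose common
nodes are external. -/
theorem iso_par_restr {K : LabHypergraph type} {P P' : Set K.V} {Q : Set K.E}
    (hPQ : ∀ e ∈ Q, ∀ σ, K.att e σ ∈ P) (hPQ' : ∀ e ∈ Qᶜ, ∀ σ, K.att e σ ∈ P')
    (hP : ∀ v, v ∈ P ∨ v ∈ P') (hP' : ∀ v ∈ P, v ∈ P' → ∃ τ, K.ext τ = some v) :
    Iso ((K.restr P Q hPQ).par (K.restr P' Qᶜ hPQ')) K := by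
  classical
  have hc : ∀ (v : P) (w : P'), (v : K.V) = w →
      (Quot.mk _ (.inl v) : ((K.restr P Q hPQ).par (K.restr P' Qᶜ hPQ')).V) =
        Quot.mk _ (.inr w) := by
    intro v w hvw
    obtain ⟨τ, hτ⟩ := hP' v v.2 (hvw ▸ w.2)
    exact par_glue (restr_ext_eq_some.2 hτ) (restr_ext_eq_some.2 (hvw ▸ hτ))
  refine ⟨Equiv.ofBijective (parLift Subtype.val Subtype.val ?_) ⟨?_, ?_⟩,
    Equiv.Set.sumCompl Q, ?_, ?_, ?_⟩
  · intro σ v w hv hw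
    exact Option.some_injective _ ((restr_ext_eq_some.1 hv).symm.trans (restr_ext_eq_some.1 hw))
  · rintro ⟨v | v⟩ ⟨w | w⟩ hvw
    · cases Subtype.val_injective hvw; rfl
    · exact hc v w hvw
    · exact (hc w v hvw.symm).symm
    · cases Subtype.val_injective hvw; rfl
  · intro v
    rcases hP v with hv | hv
    exacts [⟨Quot.mk _ (.inl ⟨v, hv⟩), rfl⟩, ⟨Quot.mk _ (.inr ⟨v, hv⟩), rfl⟩]
  · rintro (e | e) <;> rfl
  · rintro (e | e) σ h₁ h₂ <;> rfl
  · intro σ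
    cases hK : K.ext σ with
    | none =>
      have : ((K.restr P Q hPQ).par (K.restr P' Qᶜ hPQ')).ext σ = none := by
        rw [par_ext_eq_none]
        simp [restr, hK]
      rw [this, Option.map_none]
    | some v =>
      rcases hP v with hv | hv
      · rw [par_ext_left _ _ (restr_ext_eq_some (v := ⟨v, hv⟩) |>.2 hK)]
        rfl
      · rw [par_ext_right _ _ (restr_ext_eq_some (v := ⟨v, hv⟩) |>.2 hK)]
        rfl

/-- A fusion into the subhypergraph with nodes `P` and hyperedges `Q`, given by a map on nodes into
all of `K` whose actual values lie in `P`. -/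
theorem Fuses.restr {h : Var → Var} {X K : LabHypergraph type} {P : Set K.V} {Q : Set K.E}
    {hPQ : ∀ e ∈ Q, ∀ σ, K.att e σ ∈ P} (f : X.V → K.V ⊕ Var) (b : X.E ≃ Q)
    (lab : ∀ e, K.lab (b e) = X.lab e)
    (att : ∀ e σ (h₁ : σ ∈ type (X.lab e)) (h₂ : σ ∈ type (K.lab (b e))),
      f (X.att e ⟨σ, h₁⟩) = Sum.inl (K.att (b e) ⟨σ, h₂⟩))
    (ext : ∀ σ v, X.ext σ = some v → f v = K.extNode (h σ))
    (glue : ∀ v w u, f v = Sum.inl u → f w = Sum.inl u → v = w ∨ ∃ τ, K.ext τ = some u)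
    (hf : ∀ v u, f v = Sum.inl u → u ∈ P) : Fuses h X (K.restr P Q hPQ) := by
  have key : ∀ v, ∃ x : P ⊕ Var, x.map Subtype.val id = f v := by
    intro v
    cases hv : f v with
    | inl u => exact ⟨.inl ⟨u, hf v u hv⟩, rfl⟩
    | inr τ => exact ⟨.inr τ, rfl⟩
  choose f' hf' using key
  have inj : Function.Injective (Sum.map (Subtype.val : P → K.V) (id : Var → Var)) :=
    Subtype.val_injective.sumMap Function.injective_id
  refine ⟨f', b, lab, fun e σ h₁ h₂ => inj ?_, fun σ v hv => inj ?_,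
    fun v w (u : P) hv hw => ?_⟩
  · exact (hf' _).trans (att e σ h₁ h₂)
  · rw [hf', ext σ v hv]
    cases hK : K.ext (h σ) with
    | none =>
      rw [extNode_of_none hK, extNode_of_none (by simp [LabHypergraph.restr, hK])]
      rfl
    | some u =>
      have hu : u ∈ P := hf v u (by rw [ext σ v hv, extNode_of_some hK])
      rw [extNode_of_some hK, extNode_of_some (restr_ext_eq_some (v := ⟨u, hu⟩) |>.2 hK)]
      rfl
  · refine (glue v w u ?_ ?_).imp_right fun ⟨τ, hτ⟩ => ⟨τ, restr_ext_eq_some.2 hτ⟩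
    · rw [← hf', hv]; rfl
    · rw [← hf', hw]; rfl

/-- Every fusion of a parallel composition is a parallel composition of fusions. -/
theorem Fuses.exists_par {h : Var → Var} {H₁ H₂ K : LabHypergraph type}
    (F : Fuses h (H₁.par H₂) K) (hK : K.FiniteType) :
    ∃ K₁ K₂ : LabHypergraph type, Fuses h H₁ K₁ ∧ Fuses h H₂ K₂ ∧ K₁.FiniteType ∧
      K₂.FiniteType ∧ Iso (K₁.par K₂) K := by
  obtain ⟨f, b, F⟩ := F
  let P : Set K.V := {u | ∃ v : H₁.V, f (Quot.mk _ (.inl v)) = .inl u}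
  let P' : Set K.V := {u | u ∉ P ∨ ∃ τ, K.ext τ = some u}
  let Q : Set K.E := Set.range fun e => b (.inl e)
  have hPQ : ∀ e ∈ Q, ∀ σ, K.att e σ ∈ P := by
    rintro _ ⟨e, rfl⟩ ⟨σ, hσ⟩
    exact ⟨_, F.att (.inl e) σ (F.lab _ ▸ hσ) hσ⟩
  have hext : ∀ x τ u, (H₁.par H₂).ext τ = some x → f x = .inl u → ∃ τ, K.ext τ = some u := by
    intro x τ u hx hu
    exact ⟨h τ, extNode_eq_inl.1 ((F.ext τ x hx).symm.trans hu)⟩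
  -- A node with preimages on both sides is external, as its preimages are glued in the parallel
  -- composition or fused afterwards.
  have hP' : ∀ (w : H₂.V) u, f (Quot.mk _ (.inr w)) = .inl u → u ∈ P' := by
    intro w u hw
    by_cases hu : u ∈ P
    · obtain ⟨v, hv⟩ := hu
      refine .inr ?_
      rcases F.glue _ _ u hv hw with hvw | hτ
      · obtain ⟨τ, hτ⟩ := (eq_or_ext_of_par_mk_eq hvw).resolve_left nofun
        exact hext _ τ u hτ hv
      · exact hτ
    · exact .inl hu
  have hQ : ∀ e, e ∈ Qᶜ ↔ ∃ e', b (.inr e') = e := by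
    intro e
    obtain ⟨e | e, rfl⟩ := b.surjective e
    · refine iff_of_false (fun h => h ⟨e, rfl⟩) ?_
      rintro ⟨e', he'⟩
      exact Sum.inr_ne_inl (b.injective he')
    · refine iff_of_true ?_ ⟨e, rfl⟩
      rintro ⟨e', he'⟩
      exact Sum.inl_ne_inr (b.injective he')
  have hPQ' : ∀ e ∈ Qᶜ, ∀ σ, K.att e σ ∈ P' := by
    intro e he
    obtain ⟨e, rfl⟩ := (hQ e).1 he
    rintro ⟨σ, hσ⟩
    exact hP' _ _ (F.att (.inr e) σ (F.lab _ ▸ hσ) hσ)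
  refine ⟨K.restr P Q hPQ, K.restr P' Qᶜ hPQ', ?_, ?_, hK.restr, hK.restr,
    iso_par_restr hPQ hPQ' (fun v => ?_) fun v hv hv' => hv'.resolve_left fun h => h hv⟩
  · refine Fuses.restr (fun v => f (Quot.mk _ (.inl v)))
      (Equiv.ofInjective _ fun e e' h => Sum.inl_injective (b.injective h))
      (fun e => F.lab (.inl e)) (fun e σ h₁ h₂ => F.att (.inl e) σ h₁ h₂)
      (fun σ v hv => F.ext σ _ (par_ext_left _ _ hv)) (fun v w u hv hw => ?_)
      fun v u hv => ⟨v, hv⟩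
    rcases F.glue _ _ u hv hw with hvw | hτ
    · rcases eq_or_ext_of_par_mk_eq hvw with hvw | ⟨τ, hτ⟩
      · exact .inl (Sum.inl_injective hvw)
      · exact .inr (hext _ τ u hτ hv)
    · exact .inr hτ
  · have hb : Function.Bijective fun e : H₂.E => (⟨b (.inr e), (hQ _).2 ⟨e, rfl⟩⟩ : ↥Qᶜ) := by
      refine ⟨fun e e' h => Sum.inr_injective (b.injective (congrArg Subtype.val h)), ?_⟩
      rintro ⟨e, he⟩
      obtain ⟨e, rfl⟩ := (hQ e).1 he
      exact ⟨e, rfl⟩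
    refine Fuses.restr (fun v => f (Quot.mk _ (.inr v))) (Equiv.ofBijective _ hb)
      (fun e => F.lab (.inr e)) (fun e σ h₁ h₂ => F.att (.inr e) σ h₁ h₂)
      (fun σ v hv => F.ext σ _ (par_ext_right _ _ hv)) (fun v w u hv hw => ?_)
      hP'
    rcases F.glue _ _ u hv hw with hvw | hτ
    · rcases eq_or_ext_of_par_mk_eq hvw with hvw | ⟨τ, hτ⟩
      · exact .inl (Sum.inr_injective hvw)
      · exact .inr (hext _ τ u hτ hv)
    · exact .inr hτ
  · by_cases hv : v ∈ P
    exacts [.inl hv, .inr (.inl hv)]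

/-! ### Pulling selectors back -/

open Classical in
/-- Add an isolated external node for every selector in `D` that is not yet in use. -/
noncomputable def addExt (K : LabHypergraph type) (D : Finset Var) : LabHypergraph type where
  V := K.V ⊕ D
  E := K.E
  finV := by
    have := K.finV
    infer_instance
  finE := K.finE
  lab := K.lab
  att e σ := .inl (K.att e σ)
  ext τ := ((K.ext τ).map .inl).or (if hτ : τ ∈ D then some (.inr ⟨τ, hτ⟩) else none)

theorem addExt_ext_of_some {K : LabHypergraph type} {D : Finset Var} {τ : Var} {v : K.V}
    (hv : K.ext τ = some v) : (K.addExt D).ext τ = some (.inl v) := by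
  simp [addExt, hv]

theorem addExt_ext_of_mem {K : LabHypergraph type} {D : Finset Var} {τ : Var} (hτ : τ ∈ D) :
    ∃ x, (K.addExt D).ext τ = some x := by
  cases hK : K.ext τ <;> simp [addExt, hK, hτ]

theorem addExt_ext_eq_some {K : LabHypergraph type} {D : Finset Var} {τ : Var} {x : K.V ⊕ D}
    (hx : (K.addExt D).ext τ = some x) :
    (∃ v, K.ext τ = some v ∧ x = .inl v) ∨ ∃ hτ : τ ∈ D, x = .inr ⟨τ, hτ⟩ := by
  cases hK : K.ext τ with
  | some v =>
    rw [addExt_ext_of_some hK] at hx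
    exact .inl ⟨v, rfl, (Option.some.inj hx).symm⟩
  | none =>
    by_cases hτ : τ ∈ D
    · simp only [addExt, hK, Option.map_none, Option.none_or, dif_pos hτ,
        Option.some.injEq] at hx
      exact .inr ⟨hτ, hx.symm⟩
    · simp [addExt, hK, hτ] at hx

theorem FiniteType.addExt {K : LabHypergraph type} (hK : K.FiniteType) (D : Finset Var) :
    (K.addExt D).FiniteType := by
  refine (hK.union D.finite_toSet).subset ?_
  rintro τ ⟨x, hx⟩
  rcases addExt_ext_eq_some hx with ⟨v, hv, -⟩ | ⟨hτ, -⟩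
  exacts [.inl ⟨v, hv⟩, .inr hτ]

theorem Fuses.addExt (K : LabHypergraph type) (D : Finset Var) : Fuses id K (K.addExt D) :=
  ⟨fun v => .inl (.inl v), Equiv.refl _, fun _ => rfl, fun _ _ _ _ => rfl,
    fun _ _ hv => (extNode_of_some (addExt_ext_of_some hv)).symm,
    fun _ _ _ hv hw => .inl (Sum.inl_injective (Sum.inl_injective (hv.trans hw.symm)))⟩

/-- The hypergraph in which `σ` selects the node formerly selected by `h σ`. -/
def pull (h : Var → Var) (K : LabHypergraph type) : LabHypergraph type where
  V := K.V
  E := K.E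
  finV := K.finV
  finE := K.finE
  lab := K.lab
  att := K.att
  ext σ := K.ext (h σ)

/-- Pulling back along `h` is undone by a fusion along `h`; the nodes added before become virtual if
`K` has no selector for them. -/
theorem Fuses.pull_addExt (h : Var → Var) (K : LabHypergraph type) (D : Finset Var) :
    Fuses h (pull h (K.addExt D)) K := by
  refine ⟨Sum.elim .inl fun d => K.extNode d, Equiv.refl _, fun _ => rfl, fun _ _ _ _ => rfl,
    fun σ x hx => ?_, ?_⟩
  · rcases addExt_ext_eq_some hx with ⟨v, hv, rfl⟩ | ⟨hτ, rfl⟩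
    · exact (extNode_of_some hv).symm
    · rfl
  · rintro (v | d) (w | d') u hv hw
    · cases hv; cases hw; exact .inl rfl
    · exact .inr ⟨d', extNode_eq_inl.1 hw⟩
    · exact .inr ⟨d, extNode_eq_inl.1 hv⟩
    · exact .inr ⟨d, extNode_eq_inl.1 hv⟩

/-- A renaming of selectors that is onto, and injective apart from the finite set `S`. -/
structure AlmostBij (h : Var → Var) (S : Finset Var) : Prop where
  surjective : Function.Surjective h
  eq_or_mem : ∀ σ τ, h σ = h τ → σ = τ ∨ σ ∈ S

theorem FiniteType.pull {h : Var → Var} {S : Finset Var} (hh : AlmostBij h S)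
    {K : LabHypergraph type} (hK : K.FiniteType) : (pull h K).FiniteType := by
  refine (S.finite_toSet.union (Set.Finite.preimage (f := h)
    (s := {τ | ∃ v, K.ext τ = some v} \ (h '' S)) ?_ (hK.subset Set.sdiff_subset))).subset ?_
  · intro σ hσ τ _ hστ
    refine (hh.eq_or_mem σ τ hστ).resolve_right fun hS => hσ.2 ⟨σ, hS, rfl⟩
  · rintro σ ⟨v, hv⟩
    by_cases hS : σ ∈ S
    · exact .inl hS
    · refine .inr ⟨⟨v, hv⟩, ?_⟩
      rintro ⟨τ, hτ, hτσ⟩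
      rcases hh.eq_or_mem σ τ hτσ.symm with rfl | h
      exacts [hS hτ, hS h]

/-- A fusion along `h` into `K` is a fusion along the identity into the pullback of `K`, provided
that `h` is injective at the selectors that `K` does not use: the pullback has corresponding virtual
nodes. -/
theorem Fuses.pull {h : Var → Var} {S : Finset Var} (hh : AlmostBij h S)
    {X K : LabHypergraph type} (hS : ∀ σ ∈ S, ∃ v, K.ext (h σ) = some v) (F : Fuses h X K) :
    Fuses id X (pull h K) := by
  obtain ⟨f, b, F⟩ := F
  refine ⟨fun v => (f v).map id (Function.surjInv hh.surjective), b, F.lab, fun e σ h₁ h₂ => ?_,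
    fun σ v hv => ?_, fun v w u hv hw => ?_⟩
  · rw [F.att e σ h₁ h₂]; rfl
  · rw [F.ext σ v hv]
    cases hK : K.ext (h σ) with
    | some w =>
      rw [extNode_of_some hK]
      exact (extNode_of_some (K := LabHypergraph.pull h K) hK).symm
    | none =>
      rw [extNode_of_none hK]
      refine Eq.trans (congrArg Sum.inr ?_)
        (extNode_of_none (K := LabHypergraph.pull h K) hK).symm
      refine ((hh.eq_or_mem σ _ (Function.surjInv_eq hh.surjective (h σ)).symm).resolve_right
        fun h => ?_).symm
      obtain ⟨w, hw⟩ := hS σ h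
      simp [hK] at hw
  · have aux : ∀ x : K.V ⊕ Var,
        x.map id (Function.surjInv hh.surjective) = .inl u → x = .inl u := by
      rintro (x | x) hx
      · exact congrArg Sum.inl (Sum.inl_injective hx)
      · cases hx
    refine (F.glue v w u (aux _ hv) (aux _ hw)).imp_right fun ⟨τ, hτ⟩ => ?_
    obtain ⟨σ, rfl⟩ := hh.surjective τ
    exact ⟨σ, hτ⟩

/-- Renaming the selectors of `H` along `h`, composing with `K` and pulling back along `h` amounts to
composing `H` with the pullback of `K`: selectors of `H` identified by `h` are also fused in the
latter, as `K` uses their common image. -/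
theorem Fuses.pull_par_sub {h : Var → Var} {S : Finset Var} (hh : AlmostBij h S)
    {K : LabHypergraph type} (hS : ∀ σ ∈ S, ∃ v, K.ext (h σ) = some v) (H : LabHypergraph type) :
    Fuses id (LabHypergraph.pull h (K.par (H.sub h))) ((LabHypergraph.pull h K).par H) := by
  have hcase : ∀ σ τ, h σ = h τ → σ = τ ∨ ∃ v, K.ext (h σ) = some v := fun σ τ hστ =>
    (hh.eq_or_mem σ τ hστ).imp_right (hS σ)
  let K' := LabHypergraph.pull h K
  have glue : ∀ {σ : Var} {v : K.V} {w : H.V}, K.ext (h σ) = some v → H.ext σ = some w →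
      (Quot.mk _ (.inl v) : (K'.par H).V) = Quot.mk _ (.inr w) := fun hv hw =>
    par_glue (H := K') hv hw
  let q : (H.sub h).V → (K'.par H).V := Quot.lift (fun w => Quot.mk _ (.inr w)) (by
    rintro w w' ⟨σ, τ, hστ, hw, hw'⟩
    rcases hcase σ τ hστ with rfl | ⟨v, hv⟩
    · cases hw.symm.trans hw'; rfl
    · exact (glue hv hw).symm.trans (glue (hστ ▸ hv) hw'))
  refine ⟨fun x => .inl (parLift (H := K) (K := H.sub h) (fun v => Quot.mk _ (.inl v)) q ?_ x),
    Equiv.refl _, ?_, ?_, ?_, ?_⟩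
  · intro τ v x hv hx
    obtain ⟨σ, w, rfl, hw, rfl⟩ := sub_ext_eq_some hx
    exact glue hv hw
  · rintro (e | e) <;> rfl
  · rintro (e | e) σ h₁ h₂ <;> rfl
  · intro σ x hx
    cases hK : K.ext (h σ) with
    | some v =>
      cases Option.some_injective _ (hx.symm.trans (par_ext_left K (H.sub h) hK))
      exact (extNode_of_some (par_ext_left K' H hK)).symm
    | none =>
      rcases par_ext_eq_some hx with ⟨v, hv, -⟩ | ⟨y, hy, rfl⟩
      · simp [hK] at hv
      · obtain ⟨τ, w, hτ, hw, rfl⟩ := sub_ext_eq_some hy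
        rcases hcase σ τ hτ.symm with rfl | ⟨v, hv⟩
        · exact (extNode_of_some (par_ext_right K' H hw)).symm
        · simp [hK] at hv
  · have aux : ∀ x y : K.V ⊕ H.V, (Quot.mk _ x : (K'.par H).V) = Quot.mk _ y →
        (Quot.mk _ (x.map id (Quot.mk _)) : (K.par (H.sub h)).V) =
          Quot.mk _ (y.map id (Quot.mk _)) ∨
        ∃ τ, (K'.par H).ext τ = some (Quot.mk _ x) := fun x y hxy =>
      (eq_or_ext_of_par_mk_eq (H := K') hxy).imp_left fun h' => by cases h'; rfl
    rintro ⟨v | v⟩ ⟨w | w⟩ u hv hw <;> cases Sum.inl_injective hv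
    · exact aux (.inl v) (.inl w) (Sum.inl_injective hw).symm
    · obtain ⟨w, rfl⟩ := Quot.exists_rep w
      exact aux (.inl v) (.inr w) (Sum.inl_injective hw).symm
    · obtain ⟨v, rfl⟩ := Quot.exists_rep v
      exact aux (.inr v) (.inl w) (Sum.inl_injective hw).symm
    · obtain ⟨v, rfl⟩ := Quot.exists_rep v
      obtain ⟨w, rfl⟩ := Quot.exists_rep w
      exact aux (.inr v) (.inr w) (Sum.inl_injective hw).symm

end LabHypergraph

end MILL

/-! ### Hypergraphs as antecedents -/

namespace MILL

open PreFormula LabHypergraph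

variable {Var Pred : Type} {arity : Pred → ℕ}

/-- The labels of the canonical model are the formulas, with their free variables as selectors, and
one further label `none` without selectors. Hyperedges with this label make everything derivable;
they are there to make every language of the model nonempty. -/
noncomputable def labelType : Option (Formula Var arity) → Finset Var
  | none => ∅
  | some A => A.finite_FVar.toFinset

theorem mem_labelType_some {A : Formula Var arity} {σ : Var} :
    σ ∈ labelType (some A) ↔ σ ∈ A.FVar :=
  Set.Finite.mem_toFinset _

open Classical in
/-- The formula denoted by a hyperedge with label `c` whose attached nodes are named by `a`. -/
noncomputable def labelForm (c : Option (Formula Var arity)) (a : {σ // σ ∈ labelType c} → Var) :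
    Multiset (Formula Var arity) :=
  c.elim 0 fun A =>
    {A.subst fun σ => if hσ : σ ∈ labelType c then a ⟨σ, hσ⟩ else σ}

theorem labelForm_congr {c c' : Option (Formula Var arity)} (hc : c = c')
    {a : {σ // σ ∈ labelType c} → Var} {a' : {σ // σ ∈ labelType c'} → Var}
    (ha : ∀ σ (h : σ ∈ labelType c) (h' : σ ∈ labelType c'), a ⟨σ, h⟩ = a' ⟨σ, h'⟩) :
    labelForm c a = labelForm c' a' := by
  subst hc
  exact congrArg _ (funext fun σ => ha σ.1 σ.2 σ.2)

theorem labelForm_some (A : Formula Var arity) (k : Var → Var) :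
    labelForm (some A) (fun σ => k σ) = {A.subst k} := by
  refine congrArg (fun B => ({B} : Multiset (Formula Var arity))) (subst_congr A fun x hx => ?_)
  exact dif_pos (mem_labelType_some.2 hx)

namespace LabHypergraph

variable {H K : LabHypergraph (labelType (arity := arity) (Var := Var))}

/-- The multiset of formulas denoted by the hyperedges of `H` when the nodes are named by `g`. -/
noncomputable def edgeForms (H : LabHypergraph (labelType (arity := arity) (Var := Var)))
    (g : H.V → Var) : Multiset (Formula Var arity) :=
  haveI := H.finE
  letI := Fintype.ofFinite H.E
  ∑ e, labelForm (H.lab e) fun σ => g (H.att e σ)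

theorem edgeForms_eq_sum [Fintype H.E] (g : H.V → Var) :
    H.edgeForms g = ∑ e, labelForm (H.lab e) fun σ => g (H.att e σ) := by
  rw [edgeForms]
  congr!

/-- The names `g` of the nodes of `H` are those prescribed by the renaming `k` of selectors. -/
def Compat {T : Type*} {type : T → Finset Var} (H : LabHypergraph type) (g : H.V → Var)
    (k : Var → Var) : Prop :=
  ∀ σ v, H.ext σ = some v → k σ = g v

/-- Some hyperedge has the label that makes everything derivable. -/
def HasTop (H : LabHypergraph (labelType (arity := arity) (Var := Var))) : Prop :=
  ∃ e, H.lab e = none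

theorem hasTop_par : (H.par K).HasTop ↔ H.HasTop ∨ K.HasTop := by
  constructor
  · rintro ⟨e | e, he⟩
    exacts [.inl ⟨e, he⟩, .inr ⟨e, he⟩]
  · rintro (⟨e, he⟩ | ⟨e, he⟩)
    exacts [⟨.inl e, he⟩, ⟨.inr e, he⟩]

theorem edgeForms_par (g : (H.par K).V → Var) :
    (H.par K).edgeForms g = H.edgeForms (fun v => g (Quot.mk _ (.inl v))) +
      K.edgeForms (fun v => g (Quot.mk _ (.inr v))) := by
  have := H.finE
  have := K.finE
  let := Fintype.ofFinite H.E
  let := Fintype.ofFinite K.E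
  let : Fintype (H.par K).E := inferInstanceAs (Fintype (H.E ⊕ K.E))
  rw [edgeForms_eq_sum, edgeForms_eq_sum, edgeForms_eq_sum]
  exact Fintype.sum_sum_type fun e : H.E ⊕ K.E =>
    labelForm ((H.par K).lab e) fun σ => g ((H.par K).att e σ)

theorem Compat.par {T : Type*} {type : T → Finset Var} {H K : LabHypergraph type}
    {g : H.V → Var} {g' : K.V → Var} {k : Var → Var} (hg : H.Compat g k)
    (hg' : K.Compat g' k) :
    ∃ G : (H.par K).V → Var, (H.par K).Compat G k ∧ (∀ v, G (Quot.mk _ (.inl v)) = g v) ∧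
      ∀ v, G (Quot.mk _ (.inr v)) = g' v := by
  refine ⟨parLift g g' fun σ v w hv hw => (hg σ v hv).symm.trans (hg' σ w hw),
    fun σ x hx => ?_, fun _ => rfl, fun _ => rfl⟩
  rcases par_ext_eq_some hx with ⟨v, hv, rfl⟩ | ⟨v, hv, rfl⟩
  exacts [hg σ v hv, hg' σ v hv]

theorem Compat.left {T : Type*} {type : T → Finset Var} {H K : LabHypergraph type}
    {g : (H.par K).V → Var} {k : Var → Var} (hg : (H.par K).Compat g k) :
    H.Compat (fun v => g (Quot.mk _ (.inl v))) k :=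
  fun σ _ hv => hg σ _ (par_ext_left H K hv)

theorem Compat.right {T : Type*} {type : T → Finset Var} {H K : LabHypergraph type}
    {g : (H.par K).V → Var} {k : Var → Var} (hg : (H.par K).Compat g k) :
    K.Compat (fun v => g (Quot.mk _ (.inr v))) k :=
  fun σ _ hv => hg σ _ (par_ext_right H K hv)

theorem IsFusion.compat {T : Type*} {type : T → Finset Var} {H K : LabHypergraph type}
    {h : Var → Var} {f : H.V → K.V ⊕ Var} {b : H.E ≃ K.E}
    (F : IsFusion h H K f b) {g : K.V → Var} {k : Var → Var} (hg : K.Compat g k) :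
    H.Compat (fun v => Sum.elim g k (f v)) (k ∘ h) := by
  intro σ v hv
  change _ = Sum.elim g k (f v)
  rw [F.ext σ v hv, Function.comp_apply]
  cases hK : K.ext (h σ) with
  | none => rw [extNode_of_none hK, Sum.elim_inr]
  | some w => rw [extNode_of_some hK, Sum.elim_inl, hg _ w hK]

theorem IsFusion.edgeForms {h : Var → Var} {f : H.V → K.V ⊕ Var} {b : H.E ≃ K.E}
    (F : IsFusion h H K f b) (g : K.V → Var) (k : Var → Var) :
    H.edgeForms (fun v => Sum.elim g k (f v)) = K.edgeForms g := by
  have := H.finE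
  have := K.finE
  let := Fintype.ofFinite H.E
  let := Fintype.ofFinite K.E
  rw [edgeForms_eq_sum, edgeForms_eq_sum]
  refine Fintype.sum_equiv b _ _ fun e => labelForm_congr (F.lab e).symm fun σ h₁ h₂ => ?_
  exact congrArg (Sum.elim g k) (F.att e σ h₁ h₂)

theorem Fuses.hasTop {h : Var → Var} (F : Fuses h H K) (hH : H.HasTop) : K.HasTop := by
  obtain ⟨f, b, F⟩ := F
  obtain ⟨e, he⟩ := hH
  exact ⟨b e, (F.lab e).trans he⟩

/-- `H` has finite type and, under every naming of its nodes, its hyperedges prove the formula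
denoted by `A` and `e` (or it makes everything derivable). -/
def Proves (H : LabHypergraph (labelType (arity := arity) (Var := Var))) {n : ℕ}
    (A : PreFormula Var arity n) (e : Var ⊕ Fin n → Var) : Prop :=
  H.FiniteType ∧
    (H.HasTop ∨ ∀ g k, H.Compat g k → DerivableImpAll (H.edgeForms g) (A.ground (k ∘ e)))

theorem Fuses.proves {h : Var → Var} (F : Fuses h H K) (hK : K.FiniteType) {n : ℕ}
    {A : PreFormula Var arity n} {e : Var ⊕ Fin n → Var} (hH : H.Proves A e) :
    K.Proves A (h ∘ e) := by
  refine ⟨hK, hH.2.imp F.hasTop fun d g k hg => ?_⟩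
  obtain ⟨f, b, F⟩ := F
  have := d _ _ (F.compat hg)
  rwa [F.edgeForms] at this

theorem Proves.pull {h : Var → Var} {S : Finset Var} (hh : AlmostBij h S)
    (hS : ∀ σ ∈ S, ∃ v, K.ext (h σ) = some v) {n : ℕ}
    {A : PreFormula Var arity n} {e : Var ⊕ Fin n → Var} (hK : K.Proves A (h ∘ e)) :
    (LabHypergraph.pull h K).Proves A e := by
  refine ⟨hK.1.pull hh, hK.2.imp id fun d (g : K.V → Var) l hg => ?_⟩
  let r := Function.surjInv hh.surjective
  have hr : ∀ σ, h (r σ) = σ := Function.surjInv_eq hh.surjective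
  -- A compatible naming takes the same value at selectors that `h` identifies, so it descends.
  have hl : (l ∘ r) ∘ h = l := by
    funext σ
    rcases hh.eq_or_mem σ (r (h σ)) (hr _).symm with hσ | hσ
    · exact (congrArg l hσ).symm
    · obtain ⟨v, hv⟩ := hS σ hσ
      refine (hg (r (h σ)) v ?_).trans (hg σ v hv).symm
      exact (congrArg K.ext (hr _)).trans hv
  have hg' : K.Compat g (l ∘ r) := by
    intro τ v hv
    refine hg (r τ) v ?_
    exact (congrArg K.ext (hr τ)).trans hv
  have := d g (l ∘ r) hg'
  rw [← Function.comp_assoc, hl] at this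
  exact this

/-- The hypergraph with a single hyperedge, labelled by the formula `C`, all of whose nodes are
external under their own names. -/
noncomputable def single (C : Formula Var arity) :
    LabHypergraph (labelType (arity := arity) (Var := Var)) where
  V := {σ // σ ∈ labelType (some C)}
  E := Unit
  finV := inferInstance
  finE := inferInstance
  lab _ := some C
  att _ := id
  ext := open Classical in fun σ => if hσ : σ ∈ labelType (some C) then some ⟨σ, hσ⟩ else none

theorem single_ext_eq_some {C : Formula Var arity} {σ : Var}
    {v : {σ // σ ∈ labelType (some C)}} (hv : (single C).ext σ = some v) : v.1 = σ := by
  by_cases hσ : σ ∈ labelType (some C)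
  · simp only [single, dif_pos hσ, Option.some.injEq] at hv
    exact congrArg Subtype.val hv.symm
  · simp [single, hσ] at hv

theorem single_ext_of_mem {C : Formula Var arity} (v : {σ // σ ∈ labelType (some C)}) :
    (single C).ext v.1 = some v := by
  simp [single]

theorem finiteType_single (C : Formula Var arity) : (single C).FiniteType := by
  refine (labelType (some C)).finite_toSet.subset ?_
  rintro σ ⟨v, hv⟩
  rw [← single_ext_eq_some hv]
  exact v.2

theorem not_hasTop_single (C : Formula Var arity) : ¬ (single C).HasTop := by
  rintro ⟨e, he⟩
  cases he

theorem compat_single (C : Formula Var arity) (k : Var → Var) :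
    (single C).Compat (fun v => k v.1) k :=
  fun _ _ hv => congrArg k (single_ext_eq_some hv).symm

theorem edgeForms_single {C : Formula Var arity} {g : (single C).V → Var} {k : Var → Var}
    (hg : (single C).Compat g k) : (single C).edgeForms g = {C.subst k} := by
  have hgk : g = fun v => k v.1 := funext fun v => (hg v.1 v (single_ext_of_mem v)).symm
  subst hgk
  refine Eq.trans ?_ (labelForm_some C k)
  let : Unique (single C).E := inferInstanceAs (Unique Unit)
  rw [edgeForms_eq_sum, Fintype.sum_unique]
  rfl

end LabHypergraph

end MILL

/-! ### The canonical model -/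

namespace MILL

open PreFormula LabHypergraph

variable {Var Pred : Type} {arity : Pred → ℕ}

/-- The language of the formula denoted by `A` when its free variables and dangling indices are
replaced as prescribed by `e`. -/
def lang : {n : ℕ} → PreFormula Var arity n → (Var ⊕ Fin n → Var) →
    Set (LabHypergraph (labelType (arity := arity) (Var := Var)))
  | _, atom p t, e => {H | H.Proves (atom p t) e}
  | _, tensor A B, e => langPar (lang A e) (lang B e)
  | _, limp A B, e => {H | ∀ H' ∈ lang A e, H.par H' ∈ lang B e}
  | _, ex A, e => ⋃ y, lang A (envCons e y)
  | _, all A, e => ⋂ y, lang A (envCons e y)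

theorem lang_msubst {m : ℕ} (A : PreFormula Var arity m) :
    ∀ {k : ℕ} (s : Var ⊕ Fin m → Var ⊕ Fin k) (e : Var ⊕ Fin k → Var),
      lang (A.msubst s) e = lang A (e ∘ s) := by
  induction A with
  | atom p t => intros; rfl
  | tensor A B hA hB => intros; simp only [msubst, lang, hA, hB]
  | limp A B hA hB => intros; simp only [msubst, lang, hA, hB]
  | ex A hA => intros; simp only [msubst, lang, hA, envCons_comp_liftSubst]
  | all A hA => intros; simp only [msubst, lang, hA, envCons_comp_liftSubst]

theorem lang_congr {n : ℕ} (A : PreFormula Var arity n) :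
    ∀ {e e' : Var ⊕ Fin n → Var}, (∀ x ∈ A.FVar, e (.inl x) = e' (.inl x)) →
      (∀ i, e (.inr i) = e' (.inr i)) → lang A e = lang A e' := by
  induction A with
  | atom p t =>
    intro e e' h₁ h₂
    ext H
    refine and_congr_right fun _ => or_congr_right ?_
    refine forall₃_congr fun g k _ => ?_
    rw [ground_congr _ (e := k ∘ e) (e' := k ∘ e') (fun x hx => congrArg k (h₁ x hx))
      fun i => congrArg k (h₂ i)]
  | tensor A B hA hB =>
    intro e e' h₁ h₂
    simp only [lang, hA (fun x hx => h₁ x (.inl hx)) h₂, hB (fun x hx => h₁ x (.inr hx)) h₂]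
  | limp A B hA hB =>
    intro e e' h₁ h₂
    simp only [lang, hA (fun x hx => h₁ x (.inl hx)) h₂, hB (fun x hx => h₁ x (.inr hx)) h₂]
  | ex A hA =>
    intro e e' h₁ h₂
    exact Set.iUnion_congr fun y => hA h₁ (Fin.cases rfl h₂)
  | all A hA =>
    intro e e' h₁ h₂
    exact Set.iInter_congr fun y => hA h₁ (Fin.cases rfl h₂)

theorem isoClosed_lang {n : ℕ} (A : PreFormula Var arity n) :
    ∀ e : Var ⊕ Fin n → Var, IsoClosed (lang A e) := by
  induction A with
  | atom p t => exact fun e H K i hH => (Fuses.of_iso i).proves (i.finiteType hH.1) hH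
  | tensor A B hA hB => exact fun e => isoClosed_langPar _ _
  | limp A B hA hB =>
    exact fun e H K i hH H' hH' => hB e _ _ (i.par (Iso.refl H')) (hH H' hH')
  | ex A hA =>
    intro e H K i hH
    obtain ⟨y, hy⟩ := Set.mem_iUnion.1 hH
    exact Set.mem_iUnion.2 ⟨y, hA _ _ _ i hy⟩
  | all A hA =>
    exact fun e H K i hH => Set.mem_iInter.2 fun y => hA _ _ _ i (Set.mem_iInter.1 hH y)

theorem finiteType_empty {T : Type*} (type : T → Finset Var) :
    (LabHypergraph.empty type).FiniteType := by
  refine Set.finite_empty.subset ?_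
  rintro σ ⟨v, -⟩
  exact v.elim

/-- All members of a language have finite type, and some finite-type hypergraph sends all of these
into the language by parallel composition. The second part makes all languages nonempty, and this
yields the first part for implications. -/
theorem finiteType_and_exists_absorbing [Nonempty Var] {n : ℕ} (A : PreFormula Var arity n) :
    (∀ e : Var ⊕ Fin n → Var, ∀ H ∈ lang A e, H.FiniteType) ∧
    ∃ K : LabHypergraph (labelType (arity := arity) (Var := Var)), K.FiniteType ∧
      ∀ (e : Var ⊕ Fin n → Var) (H : LabHypergraph labelType), H.FiniteType →
        H.par K ∈ lang A e := by
  induction A with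
  | atom p t =>
    refine ⟨fun e H hH => hH.1, ⟨Empty, Unit, inferInstance, inferInstance, fun _ => none,
      fun _ σ => absurd σ.2 (Finset.notMem_empty _), fun _ => none⟩, ?_, fun e H hH => ⟨?_, ?_⟩⟩
    · refine Set.finite_empty.subset ?_
      rintro σ ⟨v, -⟩
      exact v.elim
    · refine finiteType_par.2 ⟨hH, ?_⟩
      refine Set.finite_empty.subset ?_
      rintro σ ⟨v, -⟩
      exact v.elim
    · exact .inl (hasTop_par.2 (.inr ⟨(), rfl⟩))
  | tensor A B hA hB =>
    obtain ⟨hA, K, hK, hAK⟩ := hA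
    obtain ⟨hB, L, hL, hBL⟩ := hB
    refine ⟨?_, K.par L, finiteType_par.2 ⟨hK, hL⟩, fun e H hH => ?_⟩
    · rintro e H ⟨H₁, h₁, H₂, h₂, i⟩
      exact i.finiteType (finiteType_par.2 ⟨hA e _ h₁, hB e _ h₂⟩)
    · exact ⟨H.par K, hAK e H hH, L, isoClosed_lang B e _ _ (Iso.empty_par L)
        (hBL e _ (finiteType_empty _)), Iso.par_assoc H K L⟩
  | limp A B hA hB =>
    obtain ⟨hA, K, hK, hAK⟩ := hA
    obtain ⟨hB, L, hL, hBL⟩ := hB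
    refine ⟨fun e H hH => ?_, L, hL, fun e H hH H' hH' => ?_⟩
    · exact (finiteType_par.1 (hB e _ (hH _ (hAK e _ (finiteType_empty _))))).1
    · refine isoClosed_lang B e _ _ ?_ (hBL e _ (finiteType_par.2 ⟨hH, hA e H' hH'⟩))
      exact (Iso.par_assoc _ _ _).trans
        (((Iso.refl H).par (Iso.par_comm _ _)).trans (Iso.par_assoc _ _ _).symm)
  | ex A hA =>
    obtain ⟨hA, K, hK, hAK⟩ := hA
    refine ⟨fun e H hH => ?_, K, hK, fun e H hH => ?_⟩
    · obtain ⟨y, hy⟩ := Set.mem_iUnion.1 hH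
      exact hA _ H hy
    · exact Set.mem_iUnion.2 ⟨Classical.arbitrary Var, hAK _ H hH⟩
  | all A hA =>
    obtain ⟨hA, K, hK, hAK⟩ := hA
    refine ⟨fun e H hH => ?_, K, hK, fun e H hH => ?_⟩
    · exact hA _ H (Set.mem_iInter.1 hH (Classical.arbitrary Var))
    · exact Set.mem_iInter.2 fun y => hAK _ H hH

theorem finiteType_of_mem_lang [Nonempty Var] {n : ℕ} {A : PreFormula Var arity n}
    {e : Var ⊕ Fin n → Var} {H : LabHypergraph labelType} (hH : H ∈ lang A e) : H.FiniteType :=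
  (finiteType_and_exists_absorbing A).1 e H hH

/-- A renaming can be changed outside a finite set so as to become a bijection there. -/
theorem exists_almostBij [Countable Var] [Infinite Var] (h : Var → Var) (S : Finset Var) :
    ∃ h', AlmostBij h' S ∧ ∀ σ ∈ S, h' σ = h σ := by
  classical
  have h₁ : Infinite {σ // σ ∉ S} := S.finite_toSet.infinite_compl.to_subtype
  have h₂ : Infinite {σ // σ ∉ S.image h} := (S.image h).finite_toSet.infinite_compl.to_subtype
  obtain ⟨φ⟩ : Nonempty ({σ // σ ∉ S} ≃ {σ // σ ∉ S.image h}) := nonempty_equiv_of_countable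
  refine ⟨fun σ => if hσ : σ ∈ S then h σ else φ ⟨σ, hσ⟩, ⟨fun τ => ?_, fun σ τ hστ => ?_⟩,
    fun σ hσ => dif_pos hσ⟩
  · by_cases hτ : τ ∈ S.image h
    · obtain ⟨σ, hσ, rfl⟩ := Finset.mem_image.1 hτ
      exact ⟨σ, dif_pos hσ⟩
    · refine ⟨φ.symm ⟨τ, hτ⟩, ?_⟩
      simp only [dif_neg (φ.symm ⟨τ, hτ⟩).2, Subtype.coe_eta, Equiv.apply_symm_apply]
  · by_cases hσ : σ ∈ S
    · exact .inr hσ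
    · refine .inl ?_
      by_cases hτ : τ ∈ S
      · simp only [dif_neg hσ, dif_pos hτ] at hστ
        exact absurd (Finset.mem_image.2 ⟨τ, hτ, hστ.symm⟩) (φ ⟨σ, hσ⟩).2
      · simp only [dif_neg hσ, dif_neg hτ] at hστ
        exact congrArg Subtype.val (φ.injective (Subtype.val_injective hστ))

/-- Only finitely many variables are assigned by `e` to free variables of `A` and dangling
indices. -/
theorem finite_envValues {n : ℕ} (A : PreFormula Var arity n) (e : Var ⊕ Fin n → Var) :
    {y | (∃ x ∈ A.FVar, e (.inl x) = y) ∨ ∃ i, e (.inr i) = y}.Finite :=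
  (A.finite_FVar.image fun x => e (.inl x)).union (Set.finite_range fun i => e (.inr i))

/-- Languages are closed under fusions along `h`, when `h` is applied to the formula, and under
pulling back along an almost bijective `h`, when `h` is removed from the formula. The parts depend
on each other: to see that a fusion `K` of a member `H` of an implication is a member, a hypergraph
in the renamed premise has to be pulled back to one that `H` can be composed with. -/
theorem lang_fuses_and_pull [Countable Var] [Infinite Var] {n : ℕ} (A : PreFormula Var arity n) :
    (∀ (h : Var → Var) (e : Var ⊕ Fin n → Var) (H K : LabHypergraph labelType), H ∈ lang A e →
      Fuses h H K → K.FiniteType → K ∈ lang A (h ∘ e)) ∧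
    ∀ (h : Var → Var) (S : Finset Var) (e : Var ⊕ Fin n → Var) (K : LabHypergraph labelType),
      AlmostBij h S → (∀ σ ∈ S, ∃ v, K.ext (h σ) = some v) → K ∈ lang A (h ∘ e) →
      pull h K ∈ lang A e := by
  classical
  induction A with
  | atom p t =>
    exact ⟨fun h e H K hH F hK => F.proves hK hH, fun h S e K hh hS hK => hK.pull hh hS⟩
  | tensor A B hA hB =>
    obtain ⟨fuseA, pullA⟩ := hA
    obtain ⟨fuseB, pullB⟩ := hB
    have fuse : ∀ (h : Var → Var) (e : Var ⊕ Fin _ → Var) (H K : LabHypergraph labelType),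
        H ∈ lang (tensor A B) e → Fuses h H K → K.FiniteType →
        K ∈ lang (tensor A B) (h ∘ e) := by
      rintro h e H K ⟨H₁, h₁, H₂, h₂, i⟩ F hK
      obtain ⟨K₁, K₂, F₁, F₂, hK₁, hK₂, j⟩ := (F.iso_left i).exists_par hK
      exact ⟨K₁, fuseA h e _ _ h₁ F₁ hK₁, K₂, fuseB h e _ _ h₂ F₂ hK₂, j⟩
    refine ⟨fuse, ?_⟩
    rintro h S e K hh hS ⟨K₁, h₁, K₂, h₂, i⟩
    have hK : K.FiniteType := i.finiteType
      (finiteType_par.2 ⟨finiteType_of_mem_lang h₁, finiteType_of_mem_lang h₂⟩)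
    -- The selectors in `h '' S` occur in `K`, but possibly not in both factors.
    have hS' : ∀ L : LabHypergraph (labelType (arity := arity) (Var := Var)),
        ∀ σ ∈ S, ∃ v, (L.addExt (S.image h)).ext (h σ) = some v := fun L σ hσ =>
      addExt_ext_of_mem (Finset.mem_image_of_mem h hσ)
    have h₁' := pullA h S e _ hh (hS' K₁) (fuseA id _ _ _ h₁ (Fuses.addExt K₁ (S.image h))
      ((finiteType_of_mem_lang h₁).addExt _))
    have h₂' := pullB h S e _ hh (hS' K₂) (fuseB id _ _ _ h₂ (Fuses.addExt K₂ (S.image h))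
      ((finiteType_of_mem_lang h₂).addExt _))
    refine fuse id e _ _ ⟨_, h₁', _, h₂', Iso.refl _⟩ (Fuses.pull hh hS ?_) (hK.pull hh)
    exact ((Fuses.pull_addExt h K₁ _).par (Fuses.pull_addExt h K₂ _)).iso_right i
  | limp A B hA hB =>
    obtain ⟨fuseA, pullA⟩ := hA
    obtain ⟨fuseB, pullB⟩ := hB
    refine ⟨fun h e H K hH F hK K' hK' => ?_, fun h S e K hh hS hK H hH => ?_⟩
    · have hHfin : H.FiniteType := finiteType_of_mem_lang (A := limp A B) hH
      let S : Finset Var := hHfin.toFinset ∪ (finite_envValues A e).toFinset ∪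
        (finite_envValues B e).toFinset
      obtain ⟨h', hh', hS⟩ := exists_almostBij h S
      have hext : ∀ σ v, H.ext σ = some v → h' σ = h σ := by
        intro σ v hv
        refine hS σ (Finset.mem_union_left _ (Finset.mem_union_left _ ?_))
        exact (Set.Finite.mem_toFinset _).2 ⟨v, hv⟩
      have hAe : lang A (h ∘ e) = lang A (h' ∘ e) := by
        have : ∀ y, y ∈ (finite_envValues A e).toFinset → h y = h' y := fun y hy =>
          (hS y (Finset.mem_union_left _ (Finset.mem_union_right _ hy))).symm
        simp only [Set.Finite.mem_toFinset] at this
        exact lang_congr A (fun x hx => this _ (.inl ⟨x, hx, rfl⟩)) fun i => this _ (.inr ⟨i, rfl⟩)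
      have hBe : lang B (h ∘ e) = lang B (h' ∘ e) := by
        have : ∀ y, y ∈ (finite_envValues B e).toFinset → h y = h' y := fun y hy =>
          (hS y (Finset.mem_union_right _ hy)).symm
        simp only [Set.Finite.mem_toFinset] at this
        exact lang_congr B (fun x hx => this _ (.inl ⟨x, hx, rfl⟩)) fun i => this _ (.inr ⟨i, rfl⟩)
      have F' : Fuses h' H K := by
        obtain ⟨f, b, F⟩ := F
        exact ⟨f, b, F.lab, F.att, fun σ v hv => by rw [hext σ v hv]; exact F.ext σ v hv, F.glue⟩
      rw [hAe] at hK'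
      rw [hBe]
      have hK'fin := finiteType_of_mem_lang hK'
      have hpull := pullA h' S e _ hh'
        (fun σ hσ => addExt_ext_of_mem (Finset.mem_image_of_mem h' hσ))
        (fuseA id _ _ _ hK' (Fuses.addExt K' (S.image h')) (hK'fin.addExt _))
      exact fuseB h' e _ _ (hH _ hpull) (F'.par (Fuses.pull_addExt h' K' _))
        (finiteType_par.2 ⟨hK, hK'fin⟩)
    · have hHfin := finiteType_of_mem_lang hH
      have hKfin : K.FiniteType := finiteType_of_mem_lang (A := limp A B) hK
      have h₁ := hK _ (fuseA h e _ _ hH (Fuses.sub h H) (hHfin.sub h))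
      have h₂ := pullB h S e _ hh (fun σ hσ => (hS σ hσ).imp' _ fun v hv => par_ext_left _ _ hv) h₁
      exact fuseB id e _ _ h₂ (Fuses.pull_par_sub hh hS H)
        (finiteType_par.2 ⟨hKfin.pull hh, hHfin⟩)
  | ex A hA =>
    obtain ⟨fuseA, pullA⟩ := hA
    refine ⟨fun h e H K hH F hK => ?_, fun h S e K hh hS hK => ?_⟩
    · obtain ⟨y, hy⟩ := Set.mem_iUnion.1 hH
      refine Set.mem_iUnion.2 ⟨h y, ?_⟩
      rw [← comp_envCons]
      exact fuseA h _ H K hy F hK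
    · obtain ⟨y, hy⟩ := Set.mem_iUnion.1 hK
      obtain ⟨y, rfl⟩ := hh.surjective y
      rw [← comp_envCons] at hy
      exact Set.mem_iUnion.2 ⟨y, pullA h S _ K hh hS hy⟩
  | all A hA =>
    obtain ⟨fuseA, pullA⟩ := hA
    refine ⟨fun h e H K hH F hK => Set.mem_iInter.2 fun z => ?_,
      fun h S e K hh hS hK => Set.mem_iInter.2 fun y => ?_⟩
    · -- The variable `z` need not be a value of `h`, but `h` may be changed at a fresh variable.
      obtain ⟨y, hy⟩ := ((finiteType_of_mem_lang (A := all A) hH).union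
        (finite_envValues (all A) e)).exists_notMem
      have hne : ∀ x, x ≠ y → Function.update h y z x = h x := fun x hx =>
        Function.update_of_ne hx _ _
      have F' : Fuses (Function.update h y z) H K := by
        obtain ⟨f, b, F⟩ := F
        refine ⟨f, b, F.lab, F.att, fun σ v hv => ?_, F.glue⟩
        rw [hne σ (by rintro rfl; exact hy (.inl ⟨v, hv⟩))]
        exact F.ext σ v hv
      have key := fuseA _ _ H K (Set.mem_iInter.1 hH y) F' hK
      rw [comp_envCons, Function.update_self] at key
      refine (Set.ext_iff.1 (lang_congr A (fun x hx => ?_) (Fin.cases rfl fun i => ?_)) K).1 key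
      · refine hne _ ?_
        rintro rfl
        exact hy (.inr (.inl ⟨x, hx, rfl⟩))
      · refine hne _ ?_
        rintro rfl
        exact hy (.inr (.inr ⟨i, rfl⟩))
    · refine pullA h S _ K hh hS ?_
      rw [comp_envCons]
      exact Set.mem_iInter.1 hK (h y)

/-- The identical assignment for formulas without dangling indices. -/
def envId : Var ⊕ Fin 0 → Var :=
  Sum.elim id (Fin.elim0 ·)

theorem ground_envId (A : Formula Var arity) (k : Var → Var) :
    A.ground (k ∘ envId) = A.subst k := by
  rw [ground, subst_eq_msubst]
  exact msubst_congr A _ _ (fun _ _ => rfl) (Fin.elim0 ·)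

theorem lang_inst (A : PreFormula Var arity 1) (y : Var) :
    lang (A.inst y) envId = lang A (envCons envId y) := by
  rw [inst_eq_msubst, lang_msubst]
  exact lang_congr A (fun _ _ => rfl) (Fin.cases rfl (Fin.elim0 ·))

/-- The canonical model. -/
noncomputable def canonicalModel [Countable Var] [Infinite Var] (arity : Pred → ℕ) :
    HypergraphLanguageModel arity (labelType (Var := Var) (arity := arity)) where
  u A := lang A envId
  iso_closed A := isoClosed_lang A envId
  sub_mem h A H hH := by
    have key := (lang_fuses_and_pull A).1 h envId H _ hH (Fuses.sub h H)
      ((finiteType_of_mem_lang hH).sub h)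
    rw [subst_eq_msubst, lang_msubst]
    rwa [lang_congr A (e := envId ∘ Sum.map h id) (e' := h ∘ envId) (fun _ _ => rfl)
      (Fin.elim0 ·)]
  tensor_eq _ _ := rfl
  limp_eq _ _ := rfl
  ex_eq A := Set.iUnion_congr fun y => (lang_inst A y).symm
  all_eq A := Set.iInter_congr fun y => (lang_inst A y).symm

/-! ### Completeness -/

/-- `H` has finite type and, in every left context, the formula denoted by `A` and `e` may be
replaced by the formulas that the hyperedges of `H` denote (or `H` makes everything derivable). -/
def Refines (H : LabHypergraph (labelType (arity := arity) (Var := Var))) {n : ℕ}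
    (A : PreFormula Var arity n) (e : Var ⊕ Fin n → Var) : Prop :=
  H.FiniteType ∧ (H.HasTop ∨ ∀ g k, H.Compat g k → ∀ (Γ : Multiset (Formula Var arity)) C,
    DerivableImpAll (A.ground (k ∘ e) ::ₘ Γ) C → DerivableImpAll (H.edgeForms g + Γ) C)

theorem refines_single {n : ℕ} (A : PreFormula Var arity n) (e : Var ⊕ Fin n → Var) :
    Refines (single (A.ground e)) A e := by
  refine ⟨finiteType_single _, .inr fun g k hg Γ C d => ?_⟩
  rw [edgeForms_single hg, subst_ground, Multiset.singleton_add]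
  exact d

/-- For formulas with `⊸` and `∀` only, the language lies between two syntactic conditions. As both
are proved together, no cut elimination is needed: each half for an implication uses the other half
for the premise. -/
theorem mem_lang_of_refines_and_proves_of_mem_lang [Infinite Var] {n : ℕ}
    (A : PreFormula Var arity n) :
    A.IsImpAll → ∀ (e : Var ⊕ Fin n → Var) (H : LabHypergraph labelType),
      (Refines H A e → H ∈ lang A e) ∧ (H ∈ lang A e → H.Proves A e) := by
  classical
  induction A with
  | atom p t =>
    refine fun _ e H => ⟨fun hH => ⟨hH.1, hH.2.imp id fun d g k hg => ?_⟩, id⟩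
    have := d g k hg 0 _ (.ax _ trivial)
    rwa [add_zero] at this
  | tensor A B => exact False.elim
  | ex A => exact False.elim
  | limp A B hA hB =>
    rintro ⟨iA, iB⟩ e H
    refine ⟨fun hH H' hH' => (hB iB e _).1 ?_, fun hH => ?_⟩
    · obtain ⟨hH'fin, hH'⟩ := (hA iA e H').2 hH'
      refine ⟨finiteType_par.2 ⟨hH.1, hH'fin⟩, ?_⟩
      rcases hH.2 with hH | hH
      · exact .inl (hasTop_par.2 (.inl hH))
      rcases hH' with hH' | hH'
      · exact .inl (hasTop_par.2 (.inr hH'))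
      refine .inr fun g k hg Γ C d => ?_
      have := hH _ k hg.left _ _ (.limpL (hH' _ k hg.right) d)
      rwa [edgeForms_par, add_assoc, add_comm (H'.edgeForms _)]
    · obtain ⟨hfin, h⟩ := (hB iB e _).2 (hH _ ((hA iA e _).1 (refines_single A e)))
      refine ⟨(finiteType_par.1 hfin).1, ?_⟩
      rcases h with h | h
      · exact .inl ((hasTop_par.1 h).resolve_right (not_hasTop_single _))
      refine .inr fun g k hg => .limpR ?_
      obtain ⟨G, hG, hG₁, hG₂⟩ := hg.par (compat_single (A.ground e) k)
      have d := h G k hG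
      rw [edgeForms_par, edgeForms_single hG.right, subst_ground, add_comm,
        Multiset.singleton_add, funext hG₁] at d
      exact d
  | all A hA =>
    intro iA e H
    refine ⟨fun hH => Set.mem_iInter.2 fun y => (hA iA _ H).1 ⟨hH.1, hH.2.imp id ?_⟩,
      fun hH => ?_⟩
    · intro d g k hg Γ C d'
      refine d g k hg Γ C (.allL (y := k y) ?_)
      rwa [inst_msubst_liftSubst, ← comp_envCons]
    · have hH' : ∀ y, H.Proves A (envCons e y) := fun y =>
        (hA iA _ H).2 (Set.mem_iInter.1 hH y)
      have hfin : H.FiniteType := (hH' (Classical.arbitrary Var)).1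
      refine ⟨hfin, or_iff_not_imp_left.2 fun hT g k hg => ?_⟩
      -- A fresh variable `y` to instantiate the bound variable, and an eigenvariable `z`.
      obtain ⟨y, hy⟩ := (hfin.union (finite_envValues (all A) e)).exists_notMem
      let B : PreFormula Var arity 1 := A.msubst (liftSubst (Sum.inl ∘ (k ∘ e)))
      have hΓ : {x | ∃ C ∈ H.edgeForms g, x ∈ C.FVar}.Finite := by
        refine ((H.edgeForms g).toFinset.finite_toSet.biUnion fun C _ => C.finite_FVar).subset ?_
        rintro x ⟨C, hC, hx⟩
        exact Set.mem_biUnion (Multiset.mem_toFinset.2 hC) hx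
      obtain ⟨z, hz⟩ := (hΓ.union B.finite_FVar).exists_notMem
      refine .allR (A := B) (z := z) (fun C hC hx => hz (.inl ⟨C, hC, hx⟩))
        (fun h => hz (.inr h)) ?_
      have hne : ∀ x, x ≠ y → Function.update k y z x = k x := fun x hx =>
        Function.update_of_ne hx _ _
      have d := ((hH' y).2.resolve_left hT) g (Function.update k y z) fun σ v hv => by
        rw [hne σ (by rintro rfl; exact hy (.inl ⟨v, hv⟩))]
        exact hg σ v hv
      rw [inst_msubst_liftSubst]
      rw [comp_envCons, Function.update_self] at d
      convert d using 1
      refine ground_congr A (fun x hx => ?_) (Fin.cases rfl fun i => ?_)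
      · refine (hne _ ?_).symm
        rintro rfl
        exact hy (.inr (.inl ⟨x, hx, rfl⟩))
      · refine (hne _ ?_).symm
        rintro rfl
        exact hy (.inr (.inr ⟨i, rfl⟩))

/-- In the canonical model, the antecedent of a sequent of the fragment contains a hypergraph that
denotes this antecedent. -/
theorem exists_mem_antecedent [Countable Var] [Infinite Var] (Γ : List (Formula Var arity))
    (hΓ : ∀ A ∈ Γ, A.IsImpAll) :
    ∃ K ∈ (canonicalModel arity).antecedent Γ, ¬ K.HasTop ∧
      ∃ g, K.Compat g id ∧ K.edgeForms g = (Γ : Multiset (Formula Var arity)) := by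
  induction Γ with
  | nil =>
    refine ⟨_, Iso.refl _, fun ⟨e, _⟩ => e.elim, Empty.elim, fun _ v => v.elim, ?_⟩
    have : IsEmpty (LabHypergraph.empty (labelType (arity := arity) (Var := Var))).E :=
      inferInstanceAs (IsEmpty Empty)
    let : Fintype (LabHypergraph.empty (labelType (arity := arity) (Var := Var))).E :=
      Fintype.ofIsEmpty
    exact (edgeForms_eq_sum _).trans (Fintype.sum_empty _)
  | cons A Γ ih =>
    obtain ⟨K, hK, hT, g, hg, hgΓ⟩ := ih fun B hB => hΓ B (List.mem_cons_of_mem _ hB)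
    have hA := (mem_lang_of_refines_and_proves_of_mem_lang A (hΓ A List.mem_cons_self) envId
      _).1 (refines_single A envId)
    obtain ⟨G, hG, -, hG₂⟩ := (compat_single (A.ground envId) id).par hg
    refine ⟨_, ⟨_, hA, K, hK, Iso.refl _⟩, ?_, G, hG, ?_⟩
    · rw [hasTop_par]
      exact fun h => h.elim (not_hasTop_single _) hT
    · rw [edgeForms_par, edgeForms_single hG.left, subst_id, funext hG₂, hgΓ,
        Multiset.singleton_add, ← Multiset.cons_coe]
      congr 1
      exact (ground_envId A id).trans (subst_id A)

theorem derivableImpAll_of_holds [Countable Var] [Infinite Var] {Γ : List (Formula Var arity)}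
    {B : Formula Var arity} (hΓ : ∀ A ∈ Γ, A.IsImpAll) (hB : B.IsImpAll)
    (h : (canonicalModel arity).Holds Γ B) :
    DerivableImpAll (Γ : Multiset (Formula Var arity)) B := by
  obtain ⟨K, hK, hT, g, hg, hgΓ⟩ := exists_mem_antecedent Γ hΓ
  have d := ((mem_lang_of_refines_and_proves_of_mem_lang B hB envId K).2
    (h hK)).2.resolve_left hT g id hg
  rwa [hgΓ, ground_envId, subst_id] at d

end MILL

theorem mainTheorem1 {Var : Type} [Countable Var] [Infinite Var] {Pred : Type}
    [Countable Pred] (arity : Pred → ℕ) :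
    (∀ (Γ : List (MILL.Formula Var arity)) (B : MILL.Formula Var arity),
      MILL.Derivable (Γ : Multiset (MILL.Formula Var arity)) B →
      ∀ (T : Type*) (type : T → Finset Var) (M : MILL.HypergraphLanguageModel arity type),
        M.Holds Γ B) ∧
    (∀ (Γ : List (MILL.Formula Var arity)) (B : MILL.Formula Var arity),
      (∀ A ∈ Γ, A.IsImpAll) → B.IsImpAll →
      (∀ (T : Type) (type : T → Finset Var) (M : MILL.HypergraphLanguageModel arity type),
        M.Holds Γ B) →
      MILL.DerivableImpAll (Γ : Multiset (MILL.Formula Var arity)) B) :=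
  ⟨fun _ _ d _ _ M => M.holds_of_derivable d,
    fun _ _ hΓ hB h => MILL.derivableImpAll_of_holds hΓ hB (h _ _ (MILL.canonicalModel arity))⟩
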